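/- **Circuits.** An *extended arithmetic circuit* with $n$ inputs, $\ell$ auxiliary memory gates and $m$ outputs is a finite simple directed acyclic graph of gates consisting of $n$ ordered input gates and $\ell$ ordered auxiliary memory gates (indegree $0$), $m$ ordered output gates (indegree $1$, outdegree $0$), gates labelled with real constants (indegree $0$), addition and multiplication gates of unbounded fan-in, and function gates (indegree and outdegree $1$), each computing a function $\mathbb{R}\to\mathbb{R}$. Given values for the input and auxiliary memory gates, every gate gets a value in the obvious way. The size is the number of gates and the depth is the length of a longest directed path. An *arithmetic circuit* is one with $\ell=0$. For $i\in\mathbb{N}$ and a set $\mathcal{B}$ of functions $\mathbb{R}\to\mathbb{R}$, a family $(C_n)_{n\in\mathbb{N}}$ of circuits, $C_n$ having $n$ inputs, is an $\mathfrak{F}$-family for $\mathfrak{F}=\mathrm{FAC}^i_{\mathbb{R}}[\mathcal{B}]$ if it has size $n^{O(1)}$, depth $O((\log n)^i)$ and all its function gates compute functions in $\mathcal{B}$. Put $\mathfrak{F}[\mathcal{A}]=\mathrm{FAC}^i_{\mathbb{R}}[\mathcal{B}\cup\mathcal{A}]$ and $\mathfrak{F}_s=\mathfrak{F}[\{\mathrm{sign}\}]$,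 where $\mathrm{sign}(x)=1$ if $x>0$ and $0$ otherwise. **Recurrent circuits.** A *recurrent arithmetic circuit* consists of an underlying extended arithmetic circuit $C$, initial values for its auxiliary memory gates, for every input and auxiliary memory gate exactly one recurrent edge into it from a gate of $C$ that is not an output gate, an ordered set of $p$ distinct halting gates of $C$, and a halting function $f_{\mathrm{halt}}\colon\mathbb{N}_{>0}\times\mathbb{R}^p\to\{0,1\}$. In iteration $k=1,2,\dots$ the circuit $C$ is evaluated on the current values of the input and auxiliary memory gates; if $f_{\mathrm{halt}}$, applied to $k$ and the values of the halting gates, is $1$, the values of the output gates are the result, and otherwise every input and auxiliary memory gate takes the value of the source of its recurrent edge. So the circuit computes a partial function, undefined where it never halts. A partial function $\mathbb{R}^*\to\mathbb{R}^*$ is in $\mathrm{rec}[\mathfrak{F}_{\mathrm{halt}}]\text{-}\mathfrak{F}$ if it is computed by a family of recurrent circuits, one for every input length, whose underlying circuits form an $\mathfrak{F}$-family and for which there is an $\mathfrak{F}_{\mathrm{halt}}$-family $(D_k)_{k\in\mathbb{N}}$ of arithmetic circuits with one output such that the halting function of every circuit of the family with $p$ halting gates is computed by $D_{p+1}$ (on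 the iteration number and the $p$ values). **Networks.** A *labelled graph* $\mathfrak{G}=(V,E,g_V)$ is a finite simple undirected graph with ordered vertex set $V$ and $g_V\colon V\to\mathbb{R}$; its encoding $\langle\mathfrak{G}\rangle\in\mathbb{R}^{|V|^2+|V|}$ is its adjacency matrix, row by row, followed by the values of $g_V$ in the order of $V$. A $\mathrm{rec}[t\mathfrak{F}_s]\text{-}(\mathrm{rec}[t\mathfrak{F}_s]\text{-}t\mathfrak{F},\mathcal{A})$-*GNN* $\textit{rec-}\mathcal{N}$ (a circuit GNN with inner and outer recurrence) consists of (a) a periodic sequence $\mathcal{N}(i)=(f^{(i)},\sigma^{(i)})$, $i\in\mathbb{N}$, where $\sigma^{(i)}\in\mathcal{A}$ and $f^{(i)}$ is a real-valued partial function on $\mathbb{R}^*$ in $\mathrm{rec}[\mathfrak{F}_s]\text{-}\mathfrak{F}$ that is tail-symmetric, i.e. invariant under permutations of all arguments but the first; and (b) a halting function $\mathrm{halt}\colon\mathbb{N}_{>0}\times\mathbb{R}^*\to\{0,1\}$, invariant under permutations of the tuple in $\mathbb{R}^*$, that is computed by an $\mathfrak{F}_s$-family of arithmetic circuits. On $\mathfrak{G}$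 put $h^{(0)}=g_V$ and $$h^{(i)}(w)=\sigma^{(i)}\Bigl(f^{(i)}\bigl(h^{(i-1)}(w),\{\!\!\{h^{(i-1)}(u)\mid \{u,w\}\in E\}\!\!\}\bigr)\Bigr)\qquad(i\ge 1,\ w\in V).$$ Then $f_{\textit{rec-}\mathcal{N}}(\mathfrak{G})=(V,E,h^{(\ell)})$ for the smallest $\ell\ge 1$ such that $h^{(\ell)}$ is defined on $V$ and $\mathrm{halt}(\ell,\{\!\!\{h^{(\ell)}(v)\mid v\in V\}\!\!\})=1$; if there is none, $f_{\textit{rec-}\mathcal{N}}(\mathfrak{G})$ is undefined. **Theorem.** Let $\mathfrak{F}=\mathrm{FAC}^i_{\mathbb{R}}[\mathcal{B}]$ for some $i\in\mathbb{N}$ and some set $\mathcal{B}$ of functions $\mathbb{R}\to\mathbb{R}$, let $\mathcal{A}$ be a set of functions $\mathbb{R}\to\mathbb{R}$, and let $\textit{rec-}\mathcal{N}$ be a $\mathrm{rec}[t\mathfrak{F}_s]\text{-}(\mathrm{rec}[t\mathfrak{F}_s]\text{-}t\mathfrak{F},\mathcal{A})$-GNN. Then there is a (partial) function $f_{\mathrm{circ}}\in\mathrm{rec}[\mathfrak{F}_s]\text{-}\mathfrak{F}_s[\mathcal{A}]$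 such that for all labelled graphs $\mathfrak{G}$ $$f_{\mathrm{circ}}(\langle\mathfrak{G}\rangle)=\langle f_{\textit{rec-}\mathcal{N}}(\mathfrak{G})\rangle,$$ where one side is defined if and only if the other one is. -/

import Mathlib

namespace RecCirc

noncomputable section

/-! ### Arithmetic circuits -/

/-- The types of gates of a circuit with `n` inputs, `ℓ` auxiliary memory gates and `m` outputs. -/
inductive GateType (n ℓ m : ℕ) : Type
  | input (j : Fin n)
  | aux (j : Fin ℓ)
  | output (j : Fin m)
  | const (c : ℝ)
  | add
  | mul
  | func (f : ℝ → ℝ)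

/-- Extended arithmetic circuits with `n` inputs, `ℓ` auxiliary memory gates and `m` outputs:
finite simple directed acyclic graphs of labelled gates. Addition and multiplication gates have
unbounded fan-in. -/
structure ExtCircuit (n ℓ m : ℕ) where
  Gate : Type
  [fintypeGate : Fintype Gate]
  label : Gate → GateType n ℓ m
  /-- `edge g h`: there is an edge from `g` to `h`. -/
  edge : Gate → Gate → Prop
  acyclic : ∀ g, ¬ Relation.TransGen edge g g
  inGate : Fin n → Gate
  auxGate : Fin ℓ → Gate
  outGate : Fin m → Gate
  label_eq_input : ∀ g j, label g = .input j ↔ g = inGate j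
  label_eq_aux : ∀ g j, label g = .aux j ↔ g = auxGate j
  label_eq_output : ∀ g j, label g = .output j ↔ g = outGate j
  input_source : ∀ j h, ¬ edge h (inGate j)
  aux_source : ∀ j h, ¬ edge h (auxGate j)
  const_source : ∀ g c, label g = .const c → ∀ h, ¬ edge h g
  output_indeg : ∀ j, ∃! h, edge h (outGate j)
  output_outdeg : ∀ j h, ¬ edge (outGate j) h
  func_indeg : ∀ g f, label g = .func f → ∃! h, edge h g
  func_outdeg : ∀ g f, label g = .func f → ∃! h, edge g h

attribute [instance] ExtCircuit.fintypeGate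

/-- Arithmetic circuits: no auxiliary memory gates. -/
abbrev Circuit (n m : ℕ) := ExtCircuit n 0 m

namespace ExtCircuit

variable {n ℓ m : ℕ} (C : ExtCircuit n ℓ m)

theorem wf_edge : WellFounded C.edge := by
  have h : WellFounded (Relation.TransGen C.edge) := by
    have : Std.Irrefl (Relation.TransGen C.edge) := ⟨C.acyclic⟩
    exact Finite.wellFounded_of_trans_of_irrefl _
  exact Subrelation.wf (fun hab => Relation.TransGen.single hab) h

open Classical in
/-- The value of a gate on input `x` with auxiliary memory values `a`. Output gates and function
gates have exactly one predecessor, so that the sums written for them have a single term. -/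
def value (x : Fin n → ℝ) (a : Fin ℓ → ℝ) : C.Gate → ℝ :=
  C.wf_edge.fix fun g rec =>
    match C.label g with
    | .input j => x j
    | .aux j => a j
    | .const c => c
    | .add => ∑ h : {h // C.edge h g}, rec h.1 h.2
    | .mul => ∏ h : {h // C.edge h g}, rec h.1 h.2
    | .output _ => ∑ h : {h // C.edge h g}, rec h.1 h.2
    | .func f => f (∑ h : {h // C.edge h g}, rec h.1 h.2)

/-- The tuple of values of the output gates. -/
def eval (x : Fin n → ℝ) (a : Fin ℓ → ℝ) : Fin m → ℝ :=
  fun j => C.value x a (C.outGate j)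

/-- The number of gates. -/
def size : ℕ := Fintype.card C.Gate

/-- The length (number of edges) of a longest directed path between two gates. -/
def depth : ℕ :=
  sSup {k | ∃ p : List C.Gate, p.IsChain C.edge ∧ p.length = k + 1}

/-- All function gates of the circuit compute functions from `A`. -/
def GatesIn (A : Set (ℝ → ℝ)) : Prop :=
  ∀ g f, C.label g = .func f → f ∈ A

open Classical in
theorem value_eq (x : Fin n → ℝ) (a : Fin ℓ → ℝ) (g : C.Gate) :
    C.value x a g =
      match C.label g with
      | .input j => x j
      | .aux j => a j
      | .const c => c
      | .add => ∑ h : {h // C.edge h g}, C.value x a h.1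
      | .mul => ∏ h : {h // C.edge h g}, C.value x a h.1
      | .output _ => ∑ h : {h // C.edge h g}, C.value x a h.1
      | .func f => f (∑ h : {h // C.edge h g}, C.value x a h.1) := by
  unfold value
  rw [WellFounded.fix_eq]

/-- The supremum in the definition of `depth` is that of a bounded set. -/
theorem bddAbove_depth :
    BddAbove {k | ∃ p : List C.Gate, p.IsChain C.edge ∧ p.length = k + 1} := by
  refine ⟨C.size, ?_⟩
  rintro k ⟨p, hp, hk⟩
  have h1 : p.Pairwise (Relation.TransGen C.edge) :=
    (hp.imp fun _ _ h => Relation.TransGen.single h).pairwise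
  have h2 : p.Nodup := by
    refine List.Pairwise.imp ?_ h1
    rintro a b h rfl
    exact C.acyclic a h
  have h3 : p.length ≤ C.size := h2.length_le_card
  omega

end ExtCircuit

/-! ### Circuit function classes -/

/-- `signFn x = 1` if `x > 0` and `signFn x = 0` otherwise. -/
def signFn (x : ℝ) : ℝ := if 0 < x then 1 else 0

/-- The data `i`, `𝓐` that determine the circuit function class `FAC^i_ℝ[𝓐]`. -/
structure CircuitClass where
  exponent : ℕ
  gates : Set (ℝ → ℝ)

namespace CircuitClass

/-- The class `𝔉[𝓐]`: the gate types of `𝔉` together with those from `𝓐`. -/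
def adjoin (F : CircuitClass) (A : Set (ℝ → ℝ)) : CircuitClass :=
  ⟨F.exponent, F.gates ∪ A⟩

/-- The class `𝔉_s = 𝔉[sign]`. -/
def withSign (F : CircuitClass) : CircuitClass := F.adjoin {signFn}

/-- `C` is an `𝔉`-circuit family: it has polynomial size, depth `O((log n)^i)`, and its function
gates are among those of `𝔉`. -/
def IsFamily (F : CircuitClass) {ℓ m : ℕ → ℕ} (C : ∀ n, ExtCircuit n (ℓ n) (m n)) : Prop :=
  (∀ n, (C n).GatesIn F.gates) ∧
  (∃ k : ℕ, (fun n => ((C n).size : ℝ)) =O[Filter.atTop] fun n : ℕ => (n : ℝ) ^ k) ∧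
  (fun n => ((C n).depth : ℝ)) =O[Filter.atTop] fun n : ℕ => Real.log n ^ F.exponent

end CircuitClass

/-- The arithmetic circuit `D` computes the halting function `halt`; its first input is the
iteration number. -/
def ComputesHalt {p : ℕ} (D : Circuit (p + 1) 1) (halt : ℕ+ → (Fin p → ℝ) → Bool) : Prop :=
  ∀ (i : ℕ+) (v : Fin p → ℝ),
    D.eval (Fin.cons ((i : ℕ) : ℝ) v) Fin.elim0 0 = if halt i v = true then 1 else 0

/-! ### Recurrent circuits -/

/-- Recurrent arithmetic circuits with `n` inputs and `m` outputs. The recurrent edges, exactly one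
into each memory gate, are given by their sources `recIn`, `recAux`; output gates have fan-out
zero, so they are no such sources. The `numHalt` halting gates are pairwise distinct and ordered. -/
structure RecCircuit (n m : ℕ) where
  numAux : ℕ
  circ : ExtCircuit n numAux m
  init : Fin numAux → ℝ
  recIn : Fin n → circ.Gate
  recAux : Fin numAux → circ.Gate
  recIn_ne : ∀ j k, recIn j ≠ circ.outGate k
  recAux_ne : ∀ j k, recAux j ≠ circ.outGate k
  numHalt : ℕ
  haltGate : Fin numHalt ↪ circ.Gate
  halt : ℕ+ → (Fin numHalt → ℝ) → Bool

namespace RecCircuit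

variable {n m : ℕ} (R : RecCircuit n m)

/-- The values of the input and auxiliary memory gates after `k` updates, on input `x`. -/
def memory (x : Fin n → ℝ) : ℕ → (Fin n → ℝ) × (Fin R.numAux → ℝ)
  | 0 => (x, R.init)
  | k + 1 =>
    let s := memory x k
    (fun j => R.circ.value s.1 s.2 (R.recIn j), fun j => R.circ.value s.1 s.2 (R.recAux j))

/-- The halting function evaluates to `1` in iteration `k + 1`. -/
def HaltsAt (x : Fin n → ℝ) (k : ℕ) : Prop :=
  R.halt k.succPNat
    (fun j => R.circ.value (R.memory x k).1 (R.memory x k).2 (R.haltGate j)) = true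

open Classical in
/-- The partial function computed by a recurrent circuit: the output values of the first iteration
in which the halting function evaluates to `1`. -/
def eval (x : Fin n → ℝ) : Part (Fin m → ℝ) :=
  Part.assert (∃ k, R.HaltsAt x k) fun h =>
    Part.some (R.circ.eval (R.memory x (Nat.find h)).1 (R.memory x (Nat.find h)).2)

end RecCircuit

/-- Recurrent circuit families. -/
structure RecFamily where
  numOut : ℕ → ℕ
  circuit : ∀ n, RecCircuit n (numOut n)

/-- The partial function `ℝ* → ℝ*` computed by a recurrent circuit family. -/
def RecFamily.eval (R : RecFamily) : List ℝ →. List ℝ :=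
  fun x => ((R.circuit x.length).eval x.get).map List.ofFn

/-- The recurrent circuit function class `rec[𝔉halt]-𝔉`: the (partial) functions computed by
recurrent circuit families whose underlying circuits form an `𝔉`-family and whose halting functions
are all members of one family of functions computed by an `𝔉halt`-family. -/
def recClass (Fhalt F : CircuitClass) : Set (List ℝ →. List ℝ) :=
  {f | ∃ R : RecFamily,
    F.IsFamily (fun n => (R.circuit n).circ) ∧
    (∃ D : ∀ k, Circuit k 1, Fhalt.IsFamily D ∧
      ∀ n, ComputesHalt (D ((R.circuit n).numHalt + 1)) (R.circuit n).halt) ∧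
    R.eval = f}

/-! ### Labelled graphs -/

/-- Labelled graphs. The ordered vertex set is `Fin order`. -/
structure LabelledGraph where
  order : ℕ
  graph : SimpleGraph (Fin order)
  feature : Fin order → ℝ

namespace LabelledGraph

open Classical in
/-- The encoding of a labelled graph: the rows of the adjacency matrix, then the features. -/
def encode (G : LabelledGraph) : List ℝ :=
  (List.ofFn fun v => List.ofFn fun w => if G.graph.Adj v w then (1 : ℝ) else 0).flatten ++
    List.ofFn G.feature

open Classical in
/-- The features, under the labelling `h`, of the neighbours of `w`, in the order of the
vertices. -/
def neighbourFeatures (G : LabelledGraph) (h : Fin G.order → ℝ) (w : Fin G.order) : List ℝ :=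
  ((List.finRange G.order).filter fun u => G.graph.Adj w u).map h

end LabelledGraph

/-! ### Recurrent circuit graph neural networks -/

/-- Invariance under permutations of all arguments but the first one. -/
def TailSymmetric (f : List ℝ →. ℝ) : Prop :=
  ∀ (x : ℝ) (l l' : List ℝ), l.Perm l' → f (x :: l) = f (x :: l')

/-- The tail-symmetric functions of the class `rec[𝔉halt]-𝔉` with one real output. -/
def tailRecClass (Fhalt F : CircuitClass) : Set (List ℝ →. ℝ) :=
  {f | TailSymmetric f ∧ (fun x => (f x).map fun y => [y]) ∈ recClass Fhalt F}

/-- Halting functions of networks that are tail-symmetric and belong to the class `𝔉`. -/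
def tailHaltClass (F : CircuitClass) : Set (ℕ+ → List ℝ → Bool) :=
  {halt | (∀ (i : ℕ+) (l l' : List ℝ), l.Perm l' → halt i l = halt i l') ∧
    ∃ D : ∀ k, Circuit k 1, F.IsFamily D ∧
      ∀ p : ℕ, ComputesHalt (D (p + 1)) fun i (v : Fin p → ℝ) => halt i (List.ofFn v)}

/-- The data of a recurrent circuit graph neural network: `layer i` consists of the function and
the activation function of the `i`th layer. -/
structure RecGNN where
  layer : ℕ → (List ℝ →. ℝ) × (ℝ → ℝ)
  halt : ℕ+ → List ℝ → Bool

namespace RecGNN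

/-- `N` is a `rec[t𝔉o]-(rec[t𝔉i]-t𝔉, 𝓐)`-GNN, with outer halting class `𝔉o` and inner halting
class `𝔉i`. -/
def IsOfType (N : RecGNN) (Fo Fi F : CircuitClass) (A : Set (ℝ → ℝ)) : Prop :=
  (∃ d, 0 < d ∧ Function.Periodic N.layer d) ∧
  (∀ i, (N.layer i).1 ∈ tailRecClass Fi F ∧ (N.layer i).2 ∈ A) ∧
  N.halt ∈ tailHaltClass Fo

/-- The labelling after `i` layers; undefined if some function evaluated on the way is. -/
def features (N : RecGNN) (G : LabelledGraph) : ℕ → Part (Fin G.order → ℝ)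
  | 0 => Part.some G.feature
  | i + 1 => (features N G i).bind fun h =>
      ⟨∀ w, ((N.layer (i + 1)).1 (h w :: G.neighbourFeatures h w)).Dom,
        fun hd w => (N.layer (i + 1)).2
          (((N.layer (i + 1)).1 (h w :: G.neighbourFeatures h w)).get (hd w))⟩

/-- The halting function evaluates to `1` after layer `k + 1`. -/
def HaltsAt (N : RecGNN) (G : LabelledGraph) (k : ℕ) : Prop :=
  ∃ h ∈ N.features G (k + 1), N.halt k.succPNat (List.ofFn h) = true

open Classical in
/-- The partial function from labelled graphs to labelled graphs computed by the network. -/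
def eval (N : RecGNN) : LabelledGraph →. LabelledGraph :=
  fun G => Part.assert (∃ k, N.HaltsAt G k) fun hk =>
    (N.features G (Nat.find hk + 1)).map fun h => ⟨G.order, G.graph, h⟩

end RecGNN

end

end RecCirc

/-!
The network is simulated by iterating one map on real vectors, and it suffices that this map, the
initial vector and the result are computed by circuits of polynomial size and depth
`O((log n) ^ i)`.

The vector consists of the adjacency matrix, the feature values, the current layer modulo the
period, and, for every vertex, every residue modulo the period and every possible number of
neighbours, the state of the recurrent circuit for the function of such a layer on that many
arguments. As the period is fixed and degrees are less than `n`, these are polynomially many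
circuits, and running all of them in parallel adds nothing to the depth. The ones that matter are
selected by 0-1 indicators, which the sign function computes. Which circuit halts first is not
known in advance, so each of them is frozen at the moment it halts, its halting flag being part of
its state; when all relevant ones have halted, the features are updated, all the circuits are
restarted for the next layer, and the halting function of the network is evaluated.
-/

namespace RecCirc

noncomputable section

/-! ### Nets -/

/-- The operations of a net with inputs `I` and gates `G`, together with their operands. -/
inductive NetOp (I G : Type) : Type
  | input (i : I)
  | const (c : ℝ)
  | add (S : Finset G)
  | mul (S : Finset G)
  | func (f : ℝ → ℝ) (g : G)

namespace NetOp

variable {I J G H : Type}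

/-- The value of an operation on input `x` if the gates have the values `v`. -/
def eval (x : I → ℝ) (v : G → ℝ) : NetOp I G → ℝ
  | input i => x i
  | const c => c
  | add S => ∑ g ∈ S, v g
  | mul S => ∏ g ∈ S, v g
  | func f g => f (v g)

/-- The operands of an operation. -/
def preds : NetOp I G → Finset G
  | input _ => ∅
  | const _ => ∅
  | add S => S
  | mul S => S
  | func _ g => {g}

/-- The operation obtained by renaming the gates along `φ` and replacing every input `i` by the
operation `ψ i`. -/
def bind (φ : G ↪ H) (ψ : I → NetOp J H) : NetOp I G → NetOp J H
  | input i => ψ i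
  | const c => const c
  | add S => add (S.map φ)
  | mul S => mul (S.map φ)
  | func f g => func f (φ g)

theorem eval_bind (φ : G ↪ H) (ψ : I → NetOp J H) (y : J → ℝ) (v : H → ℝ) (o : NetOp I G) :
    (o.bind φ ψ).eval y v = o.eval (fun i => (ψ i).eval y v) (fun g => v (φ g)) := by
  cases o <;> simp [bind, eval]

theorem eval_congr {x : I → ℝ} {v w : G → ℝ} {o : NetOp I G} (h : ∀ g ∈ o.preds, v g = w g) :
    o.eval x v = o.eval x w := by
  cases o with
  | input | const => rfl
  | add S => exact Finset.sum_congr rfl h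
  | mul S => exact Finset.prod_congr rfl h
  | func f g => exact congrArg f (h g (Finset.mem_singleton_self g))

theorem mem_preds_bind {φ : G ↪ H} {ψ : I → NetOp J H} {o : NetOp I G} {h : H}
    (hh : h ∈ (o.bind φ ψ).preds) :
    (∃ g ∈ o.preds, φ g = h) ∨ ∃ i, h ∈ (ψ i).preds := by
  cases o with
  | input i => exact Or.inr ⟨i, hh⟩
  | _ => simp_all [bind, preds]

theorem bind_eq_func {φ : G ↪ H} {ψ : I → NetOp J H} {o : NetOp I G} {f : ℝ → ℝ} {h : H}
    (hh : o.bind φ ψ = func f h) :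
    (∃ g, o = func f g) ∨ ∃ i, ψ i = func f h := by
  cases o with
  | input i => exact Or.inr ⟨i, hh⟩
  | func f' g => exact Or.inl ⟨g, by simp_all [bind]⟩
  | _ => simp [bind] at hh

theorem mem_preds_bind_input {φ : G ↪ H} {q : I → J} {o : NetOp I G} {h : H}
    (hh : h ∈ (o.bind φ fun i => input (q i)).preds) : ∃ g ∈ o.preds, φ g = h :=
  (mem_preds_bind hh).resolve_right (by simp [preds])

theorem bind_input_eq_func {φ : G ↪ H} {q : I → J} {o : NetOp I G} {f : ℝ → ℝ} {h : H}
    (hh : (o.bind φ fun i => input (q i)) = func f h) : ∃ g, o = func f g :=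
  (bind_eq_func hh).resolve_right (by simp)

end NetOp

/-- Finite directed acyclic graphs of operations whose functions belong to `B`. In contrast to
those of circuits, their gates have no prescribed order or fan-out and there are no output gates;
acyclicity is witnessed by a rank function, which also bounds the depth. -/
structure Net (B : Set (ℝ → ℝ)) (I : Type) where
  Gate : Type
  [fintypeGate : Fintype Gate]
  op : Gate → NetOp I Gate
  rank : Gate → ℕ
  rank_lt : ∀ g, ∀ h ∈ (op g).preds, rank h < rank g
  func_mem : ∀ g f h, op g = .func f h → f ∈ B

attribute [instance] Net.fintypeGate

namespace Net

variable {B : Set (ℝ → ℝ)} {I J M : Type}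

/-- `v` assigns to the gates of the net their values on input `x`. -/
def IsValuation (N : Net B I) (x : I → ℝ) (v : N.Gate → ℝ) : Prop :=
  ∀ g, v g = (N.op g).eval x v

/-- The largest rank of a gate. -/
def depth (N : Net B I) : ℕ := Finset.univ.sup N.rank

theorem rank_le_depth (N : Net B I) (g : N.Gate) : N.rank g ≤ N.depth :=
  Finset.le_sup (f := N.rank) (Finset.mem_univ g)

theorem depth_le_iff {N : Net B I} {d : ℕ} : N.depth ≤ d ↔ ∀ g, N.rank g ≤ d := by
  simp [depth]

/-- The net of one operation, which is applied to the inputs. -/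
def ofOp [Fintype I] (o : NetOp Empty I) (ho : ∀ f i, o = .func f i → f ∈ B) : Net B I where
  Gate := Option I
  op g := g.elim (o.bind .some Empty.elim) .input
  rank g := g.elim 1 fun _ => 0
  rank_lt := by
    rintro (_ | i) h hh
    · obtain ⟨j, -, rfl⟩ | ⟨e, -⟩ := NetOp.mem_preds_bind hh
      · exact Nat.zero_lt_one
      · exact e.elim
    · simp [NetOp.preds] at hh
  func_mem := by
    rintro (_ | i) f h hh
    · obtain ⟨j, hj⟩ | ⟨e, -⟩ := NetOp.bind_eq_func hh
      · exact ho f j hj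
      · exact e.elim
    · simp at hh

theorem isValuation_ofOp [Fintype I] (o : NetOp Empty I) (ho : ∀ f i, o = .func f i → f ∈ B)
    (x : I → ℝ) : (ofOp o ho).IsValuation x fun g => g.elim (o.eval Empty.elim x) x := by
  rintro (_ | i)
  · exact ((NetOp.eval_bind ..).trans
      (congrArg (fun z => o.eval z x) (funext fun e => e.elim))).symm
  · rfl

/-- Replacing every input `i` by the input `q i`. -/
def rename (N : Net B I) (q : I → J) : Net B J where
  Gate := N.Gate
  op g := (N.op g).bind (.refl _) fun i => .input (q i)
  rank := N.rank
  rank_lt g h hh := by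
    obtain ⟨g', hg', rfl⟩ := NetOp.mem_preds_bind_input hh
    exact N.rank_lt g g' hg'
  func_mem g f h hh := by
    obtain ⟨g', hg'⟩ := NetOp.bind_input_eq_func hh
    exact N.func_mem g f g' hg'

theorem IsValuation.rename {N : Net B I} {q : I → J} {y : J → ℝ} {v : N.Gate → ℝ}
    (hv : N.IsValuation (fun i => y (q i)) v) : (N.rename q).IsValuation y v := fun g =>
  (hv g).trans (NetOp.eval_bind (.refl _) (fun i => .input (q i)) y v (N.op g)).symm

/-- The disjoint union of a finite family of nets with the same inputs. -/
def sigma [Fintype M] (K : M → Net B I) : Net B I where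
  Gate := Σ m, (K m).Gate
  op p := ((K p.1).op p.2).bind (.sigmaMk p.1) .input
  rank p := (K p.1).rank p.2
  rank_lt p h hh := by
    obtain ⟨g, hg, rfl⟩ := NetOp.mem_preds_bind_input hh
    exact (K p.1).rank_lt p.2 g hg
  func_mem p f h hh := by
    obtain ⟨g, hg⟩ := NetOp.bind_input_eq_func hh
    exact (K p.1).func_mem p.2 f g hg

theorem IsValuation.sigma [Fintype M] {K : M → Net B I} {x : I → ℝ} {v : ∀ m, (K m).Gate → ℝ}
    (hv : ∀ m, (K m).IsValuation x (v m)) : (Net.sigma K).IsValuation x fun p => v p.1 p.2 :=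
  fun p => (hv p.1 p.2).trans
    (NetOp.eval_bind (.sigmaMk p.1) .input x (fun p : Σ m, (K m).Gate => v p.1 p.2) _).symm

/-- Feeding the gate `q m` of `K` into the input `m` of `N`. The inputs of `N` become addition
gates with a single operand. -/
def comp (N : Net B M) (K : Net B I) (q : M → K.Gate) : Net B I where
  Gate := K.Gate ⊕ N.Gate
  op := Sum.elim (fun g => (K.op g).bind .inl .input)
    (fun g => (N.op g).bind .inr fun m => .add {Sum.inl (q m)})
  rank := Sum.elim K.rank fun g => K.depth + 1 + N.rank g
  rank_lt := by
    rintro (g | g) h hh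
    · obtain ⟨g', hg', rfl⟩ := NetOp.mem_preds_bind_input hh
      exact K.rank_lt g g' hg'
    · obtain ⟨g', hg', rfl⟩ | ⟨m, hm⟩ := NetOp.mem_preds_bind hh
      · exact Nat.add_lt_add_left (N.rank_lt g g' hg') _
      · obtain rfl := Finset.mem_singleton.1 hm
        exact (Nat.lt_succ_of_le (K.rank_le_depth (q m))).trans_le (Nat.le_add_right _ _)
  func_mem := by
    rintro (g | g) f h hh
    · obtain ⟨g', hg'⟩ := NetOp.bind_input_eq_func hh
      exact K.func_mem g f g' hg'
    · obtain ⟨g', hg'⟩ | ⟨m, hm⟩ := NetOp.bind_eq_func hh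
      · exact N.func_mem g f g' hg'
      · simp at hm

theorem IsValuation.comp {N : Net B M} {K : Net B I} {q : M → K.Gate} {x : I → ℝ}
    {v : N.Gate → ℝ} {u : K.Gate → ℝ} (hv : N.IsValuation (fun m => u (q m)) v)
    (hu : K.IsValuation x u) : (N.comp K q).IsValuation x (Sum.elim u v) := by
  rintro (g | g)
  · exact (hu g).trans (NetOp.eval_bind .inl .input x (Sum.elim u v) (K.op g)).symm
  · refine ((hv g).trans ?_).trans (NetOp.eval_bind .inr _ x (Sum.elim u v) (N.op g)).symm
    simp [NetOp.eval]

theorem depth_comp_le (N : Net B M) (K : Net B I) (q : M → K.Gate) :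
    (N.comp K q).depth ≤ K.depth + 1 + N.depth := by
  refine depth_le_iff.2 ?_
  rintro (g | g)
  · exact (K.rank_le_depth g).trans (by lia)
  · exact Nat.add_le_add_left (N.rank_le_depth g) _

end Net

/-- The function `f` is computed by a net with at most `s` gates and depth at most `d`. -/
def NetComputable (B : Set (ℝ → ℝ)) {I : Type} (f : (I → ℝ) → ℝ) (s d : ℕ) : Prop :=
  ∃ (N : Net B I) (o : N.Gate), (∀ x, ∃ v, N.IsValuation x v ∧ v o = f x) ∧
    Fintype.card N.Gate ≤ s ∧ N.depth ≤ d

namespace NetComputable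

variable {B : Set (ℝ → ℝ)} {I J M : Type}

theorem mono {f : (I → ℝ) → ℝ} {s d s' d' : ℕ} (h : NetComputable B f s d) (hs : s ≤ s')
    (hd : d ≤ d') : NetComputable B f s' d' := by
  obtain ⟨N, o, hf, hsize, hdepth⟩ := h
  exact ⟨N, o, hf, hsize.trans hs, hdepth.trans hd⟩

theorem of_op [Fintype I] (o : NetOp Empty I) (ho : ∀ f i, o = .func f i → f ∈ B) :
    NetComputable B (o.eval Empty.elim) (Fintype.card I + 1) 1 := by
  refine ⟨.ofOp o ho, none, fun x => ⟨_, Net.isValuation_ofOp o ho x, rfl⟩,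
    (Fintype.card_option (α := I)).le, Net.depth_le_iff.2 ?_⟩
  rintro (_ | _)
  · exact le_rfl
  · exact Nat.zero_le 1

theorem sum [Fintype I] : NetComputable B (fun x : I → ℝ => ∑ i, x i) (Fintype.card I + 1) 1 :=
  of_op (.add Finset.univ) (by simp)

theorem prod [Fintype I] : NetComputable B (fun x : I → ℝ => ∏ i, x i) (Fintype.card I + 1) 1 :=
  of_op (.mul Finset.univ) (by simp)

theorem func {f : ℝ → ℝ} (hf : f ∈ B) : NetComputable B (fun x : Unit → ℝ => f (x ())) 2 1 :=
  of_op (.func f ()) (by rintro g _ ⟨⟩; exact hf)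

theorem rename {f : (I → ℝ) → ℝ} {s d : ℕ} (h : NetComputable B f s d) (q : I → J) :
    NetComputable B (fun y => f fun i => y (q i)) s d := by
  obtain ⟨N, o, hf, hsize, hdepth⟩ := h
  refine ⟨N.rename q, o, fun y => ?_, hsize, hdepth⟩
  obtain ⟨v, hv, hvo⟩ := hf fun i => y (q i)
  exact ⟨v, hv.rename, hvo⟩

theorem var (i : I) : NetComputable B (fun x => x i) 2 1 := by
  simpa using (sum (I := Unit)).rename fun _ => i

theorem const (c : ℝ) : NetComputable B (fun _ : I → ℝ => c) 1 1 :=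
  (of_op (.const c) (by simp)).rename Empty.elim

theorem exists_net [Fintype M] {g : M → (I → ℝ) → ℝ} {s d : ℕ}
    (hg : ∀ m, NetComputable B (g m) s d) :
    ∃ (K : Net B I) (q : M → K.Gate),
      (∀ x, ∃ v, K.IsValuation x v ∧ ∀ m, v (q m) = g m x) ∧
      Fintype.card K.Gate ≤ Fintype.card M * s ∧ K.depth ≤ d := by
  choose K q hval hsize hdepth using hg
  refine ⟨.sigma K, fun m => ⟨m, q m⟩, fun x => ?_, ?_,
    Net.depth_le_iff.2 fun p => ((K p.1).rank_le_depth p.2).trans (hdepth p.1)⟩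
  · choose u hu huq using fun m => hval m x
    exact ⟨_, .sigma hu, huq⟩
  · calc Fintype.card (Net.sigma K).Gate = ∑ m, Fintype.card (K m).Gate := Fintype.card_sigma
      _ ≤ ∑ _m : M, s := Finset.sum_le_sum fun m _ => hsize m
      _ = Fintype.card M * s := by simp

theorem subst [Fintype M] {f : (M → ℝ) → ℝ} {g : M → (I → ℝ) → ℝ} {s d s' d' : ℕ}
    (hf : NetComputable B f s d) (hg : ∀ m, NetComputable B (g m) s' d') :
    NetComputable B (fun x => f fun m => g m x) (s + Fintype.card M * s') (d + d' + 1) := by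
  obtain ⟨N, o, hN, hNsize, hNdepth⟩ := hf
  obtain ⟨K, q, hK, hKsize, hKdepth⟩ := exists_net hg
  refine ⟨N.comp K q, Sum.inr o, fun x => ?_, ?_, (N.depth_comp_le K q).trans (by lia)⟩
  · obtain ⟨u, hu, huq⟩ := hK x
    obtain ⟨v, hv, hvo⟩ := hN fun m => g m x
    simp only [← huq] at hv
    exact ⟨Sum.elim u v, hv.comp hu, hvo⟩
  · exact Fintype.card_sum.trans_le (by lia)

end NetComputable

/-! ### Circuits as nets -/

namespace ExtCircuit

variable {n ℓ m : ℕ} (C : ExtCircuit n ℓ m)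

theorem auxGate_injective : Function.Injective C.auxGate := fun j k h => by
  have hj := (C.label_eq_aux _ j).2 rfl
  rw [(C.label_eq_aux _ k).2 h] at hj
  exact (GateType.aux.inj hj).symm

section Height

/-- The length of a longest directed path that ends in `g`. -/
def height (g : C.Gate) : ℕ :=
  sSup {k | ∃ p : List C.Gate, (p ++ [g]).IsChain C.edge ∧ p.length = k}

variable {C}

theorem length_le_depth {p : List C.Gate} {g : C.Gate} (hp : (p ++ [g]).IsChain C.edge) :
    p.length ≤ C.depth :=
  le_csSup C.bddAbove_depth ⟨p ++ [g], hp, by simp⟩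

theorem exists_length_eq_height (g : C.Gate) :
    ∃ p : List C.Gate, (p ++ [g]).IsChain C.edge ∧ p.length = C.height g := by
  refine Nat.sSup_mem (s := {k | ∃ p : List C.Gate, (p ++ [g]).IsChain C.edge ∧ p.length = k})
    ⟨0, [], by simp, rfl⟩ ⟨C.depth, ?_⟩
  rintro k ⟨p, hp, rfl⟩
  exact length_le_depth hp

theorem length_le_height {p : List C.Gate} {g : C.Gate} (hp : (p ++ [g]).IsChain C.edge) :
    p.length ≤ C.height g := by
  refine le_csSup ⟨C.depth, ?_⟩ ⟨p, hp, rfl⟩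
  rintro k ⟨p, hp, rfl⟩
  exact length_le_depth hp

theorem height_le_depth (g : C.Gate) : C.height g ≤ C.depth := by
  obtain ⟨p, hp, hlen⟩ := exists_length_eq_height g
  exact hlen ▸ length_le_depth hp

theorem height_lt_height {g h : C.Gate} (hgh : C.edge g h) : C.height g < C.height h := by
  obtain ⟨p, hp, hlen⟩ := exists_length_eq_height g
  have hchain : ((p ++ [g]) ++ [h]).IsChain C.edge :=
    List.isChain_append.2 ⟨hp, by simp, by simpa using hgh⟩
  calc C.height g < (p ++ [g]).length := by simp [hlen]
    _ ≤ C.height h := length_le_height hchain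

theorem depth_le_of_rank {d : ℕ} (r : C.Gate → ℕ) (hr : ∀ g h, C.edge g h → r g < r h)
    (hd : ∀ g, r g ≤ d) : C.depth ≤ d := by
  refine csSup_le' ?_
  rintro k ⟨p, hp, hlen⟩
  let rank (g : C.Gate) : Fin (d + 1) := ⟨r g, Nat.lt_succ_of_le (hd g)⟩
  have hsorted : (p.map rank).Pairwise (· < ·) :=
    ((List.isChain_map rank).2 (hp.imp fun g h => hr g h)).pairwise
  have hnodup : (p.map rank).Nodup := hsorted.imp ne_of_lt
  have hcard := hnodup.length_le_card
  simp only [List.length_map, Fintype.card_fin, hlen] at hcard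
  exact Nat.le_of_succ_le_succ hcard

end Height

section Value

variable {C} {x : Fin n → ℝ} {a : Fin ℓ → ℝ} {g : C.Gate}

theorem value_of_input {j : Fin n} (hg : C.label g = .input j) : C.value x a g = x j := by
  rw [C.value_eq, hg]

theorem value_of_aux {j : Fin ℓ} (hg : C.label g = .aux j) : C.value x a g = a j := by
  rw [C.value_eq, hg]

theorem value_of_const {c : ℝ} (hg : C.label g = .const c) : C.value x a g = c := by
  rw [C.value_eq, hg]

theorem value_of_add {S : Finset C.Gate} (hg : C.label g = .add) (hS : ∀ h, h ∈ S ↔ C.edge h g) :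
    C.value x a g = ∑ h ∈ S, C.value x a h := by
  rw [C.value_eq, hg, Finset.sum_subtype S hS]

theorem value_of_mul {S : Finset C.Gate} (hg : C.label g = .mul) (hS : ∀ h, h ∈ S ↔ C.edge h g) :
    C.value x a g = ∏ h ∈ S, C.value x a h := by
  rw [C.value_eq, hg, Finset.prod_subtype S hS]

open Classical in
theorem sum_edge_of_unique {h : C.Gate} (hS : ∀ h', C.edge h' g ↔ h' = h) :
    ∑ h : {h // C.edge h g}, C.value x a h.1 = C.value x a h := by
  rw [← Finset.sum_subtype {h} (fun h' => by simp [hS]), Finset.sum_singleton]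

theorem value_of_output {j : Fin m} {h : C.Gate} (hg : C.label g = .output j)
    (hS : ∀ h', C.edge h' g ↔ h' = h) : C.value x a g = C.value x a h := by
  rw [C.value_eq, hg]
  exact sum_edge_of_unique hS

theorem value_of_func {f : ℝ → ℝ} {h : C.Gate} (hg : C.label g = .func f)
    (hS : ∀ h', C.edge h' g ↔ h' = h) : C.value x a g = f (C.value x a h) := by
  rw [C.value_eq, hg]
  exact congrArg f (sum_edge_of_unique hS)

variable (g)

theorem exists_netOp : ∃ o : NetOp (Fin n ⊕ Fin ℓ) C.Gate,
    (∀ h ∈ o.preds, C.edge h g) ∧ (∀ f h, o = .func f h → C.label g = .func f) ∧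
    ∀ x a, C.value x a g = o.eval (Sum.elim x a) (C.value x a) := by
  classical
  have hpred : ∀ h, h ∈ ({h | C.edge h g} : Finset C.Gate) ↔ C.edge h g := by simp
  cases hg : C.label g with
  | input j => exact ⟨.input (.inl j), by simp [NetOp.preds], by simp, fun _ _ => value_of_input hg⟩
  | aux j => exact ⟨.input (.inr j), by simp [NetOp.preds], by simp, fun _ _ => value_of_aux hg⟩
  | const c => exact ⟨.const c, by simp [NetOp.preds], by simp, fun _ _ => value_of_const hg⟩
  | add => exact ⟨.add _, fun h => (hpred h).1, by simp, fun _ _ => value_of_add hg hpred⟩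
  | mul => exact ⟨.mul _, fun h => (hpred h).1, by simp, fun _ _ => value_of_mul hg hpred⟩
  | output j =>
    obtain rfl := (C.label_eq_output g j).1 hg
    obtain ⟨h, hedge, hunique⟩ := C.output_indeg j
    refine ⟨.add {h}, by simpa [NetOp.preds] using hedge, by simp, fun x a => ?_⟩
    rw [value_of_output hg fun h' => ⟨hunique h', fun e => e ▸ hedge⟩]
    simp [NetOp.eval]
  | func f =>
    obtain ⟨h, hedge, hunique⟩ := C.func_indeg g f hg
    exact ⟨.func f h, by simpa [NetOp.preds] using hedge, by simp,
      fun x a => value_of_func hg fun h' => ⟨hunique h', fun e => e ▸ hedge⟩⟩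

theorem netComputable_value {B : Set (ℝ → ℝ)} (hB : C.GatesIn B) :
    NetComputable B (fun s : Fin n ⊕ Fin ℓ → ℝ => C.value (s ∘ Sum.inl) (s ∘ Sum.inr) g)
      C.size C.depth := by
  choose op hpreds hfunc hval using C.exists_netOp
  let N : Net B (Fin n ⊕ Fin ℓ) :=
    { Gate := C.Gate
      op := op
      rank := C.height
      rank_lt := fun g h hh => height_lt_height (hpreds g h hh)
      func_mem := fun g f h hh => hB g f (hfunc g f h hh) }
  refine ⟨N, g, fun s => ⟨C.value (s ∘ Sum.inl) (s ∘ Sum.inr), fun g => ?_, rfl⟩, le_rfl,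
    Net.depth_le_iff.2 height_le_depth⟩
  rw [hval, Sum.elim_comp_inl_inr]

end Value

end ExtCircuit

/-! ### Nets as circuits -/

/-- The gates of the circuit of a net: memory gates, output gates, and for every gate of the net a
gate for its operation and one that copies the value of the latter. The copies make the outdegree
of function gates equal to `1`. -/
inductive NetGate (n ℓ m : ℕ) (G : Type) : Type
  | mem (i : Fin n ⊕ Fin ℓ)
  | out (j : Fin m)
  | comp (g : G)
  | copy (g : G)

namespace NetGate

variable (n ℓ m : ℕ) (G : Type)

/-- The gates of the circuit of a net as a sum type. -/
def equivSum : (Fin n ⊕ Fin ℓ) ⊕ (Fin m ⊕ (G ⊕ G)) ≃ NetGate n ℓ m G where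
  toFun := Sum.elim mem (Sum.elim out (Sum.elim comp copy))
  invFun
    | mem i => .inl i
    | out j => .inr (.inl j)
    | comp g => .inr (.inr (.inl g))
    | copy g => .inr (.inr (.inr g))
  left_inv := by rintro (i | j | g | g) <;> rfl
  right_inv := by rintro (i | j | g | g) <;> rfl

instance [Fintype G] : Fintype (NetGate n ℓ m G) := Fintype.ofEquiv _ (equivSum n ℓ m G)

theorem card_eq [Fintype G] :
    Fintype.card (NetGate n ℓ m G) = n + ℓ + m + 2 * Fintype.card G := by
  rw [← Fintype.card_congr (equivSum n ℓ m G)]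
  simp only [Fintype.card_sum, Fintype.card_fin]
  ring

variable {n ℓ m G}

/-- `NetGate.copy` as an embedding. -/
def copyEmbedding : G ↪ NetGate n ℓ m G := ⟨copy, fun _ _ h => copy.inj h⟩

/-- The label of the gate for an operation. -/
def opLabel {I : Type} : NetOp I G → GateType n ℓ m
  | .input _ => .add
  | .const c => .const c
  | .add _ => .add
  | .mul _ => .mul
  | .func f _ => .func f

/-- The predecessors of the gate for an operation. -/
def opPreds : NetOp (Fin n ⊕ Fin ℓ) G → Finset (NetGate n ℓ m G)
  | .input i => {mem i}
  | o => o.preds.map copyEmbedding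

theorem mem_opPreds {o : NetOp (Fin n ⊕ Fin ℓ) G} {h : NetGate n ℓ m G} (hh : h ∈ opPreds o) :
    (∃ i, mem i = h) ∨ ∃ g ∈ o.preds, copy g = h := by
  cases o with
  | input i => exact Or.inl ⟨i, (Finset.mem_singleton.1 hh).symm⟩
  | _ => exact Or.inr (Finset.mem_map.1 hh)

theorem mem_opPreds_func {f : ℝ → ℝ} {g : G} {h : NetGate n ℓ m G} :
    h ∈ opPreds (.func f g) ↔ h = copy g := by
  simp only [opPreds, NetOp.preds, Finset.map_singleton, Finset.mem_singleton]
  rfl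

theorem exists_eq_func_of_opLabel_eq {I : Type} {o : NetOp I G} {f : ℝ → ℝ}
    (h : opLabel o = (.func f : GateType n ℓ m)) : ∃ g, o = .func f g := by
  cases o <;> simp_all [opLabel]

end NetGate

namespace Net

open NetGate

variable {B : Set (ℝ → ℝ)} {n ℓ m : ℕ} (N : Net B (Fin n ⊕ Fin ℓ)) (out : Fin m → N.Gate)

/-- The labels of the circuit of a net. -/
def circuitLabel : NetGate n ℓ m N.Gate → GateType n ℓ m
  | .mem (.inl j) => .input j
  | .mem (.inr j) => .aux j
  | .out j => .output j
  | .comp g => opLabel (N.op g)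
  | .copy _ => .add

/-- The edges of the circuit of a net, the `j`th output gate of which is fed by `out j`. -/
def circuitEdge (h : NetGate n ℓ m N.Gate) : NetGate n ℓ m N.Gate → Prop
  | .mem _ => False
  | .out j => h = .copy (out j)
  | .comp g => h ∈ opPreds (N.op g)
  | .copy g => h = .comp g

/-- A rank function for the circuit of a net. -/
def circuitRank : NetGate n ℓ m N.Gate → ℕ
  | .mem _ => 0
  | .out _ => 2 * N.depth + 3
  | .comp g => 2 * N.rank g + 1
  | .copy g => 2 * N.rank g + 2

theorem circuitRank_le (g : NetGate n ℓ m N.Gate) : N.circuitRank g ≤ 2 * N.depth + 3 := by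
  cases g with
  | mem | out => simp [circuitRank]
  | comp g | copy g => have := N.rank_le_depth g; simp only [circuitRank]; lia

theorem circuitRank_lt {g h : NetGate n ℓ m N.Gate} (hgh : N.circuitEdge out g h) :
    N.circuitRank g < N.circuitRank h := by
  cases h with
  | mem i => exact hgh.elim
  | out j =>
    obtain rfl : g = _ := hgh
    have := N.rank_le_depth (out j)
    simp only [circuitRank]
    lia
  | comp h =>
    obtain ⟨i, rfl⟩ | ⟨g, hg, rfl⟩ := mem_opPreds hgh
    · exact Nat.succ_pos _
    · have := N.rank_lt h g hg
      simp only [circuitRank]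
      lia
  | copy h =>
    obtain rfl : g = _ := hgh
    exact Nat.lt_succ_self _

theorem acyclic_circuitEdge (g : NetGate n ℓ m N.Gate) :
    ¬ Relation.TransGen (N.circuitEdge out) g g := fun h => by
  have hrank : Relation.TransGen (· < ·) (N.circuitRank g) (N.circuitRank g) :=
    h.lift N.circuitRank fun _ _ => N.circuitRank_lt out
  rw [Relation.transGen_eq_self] at hrank
  exact lt_irrefl _ hrank

theorem not_circuitEdge_out (j : Fin m) (h : NetGate n ℓ m N.Gate) :
    ¬ N.circuitEdge out (.out j) h := by
  intro e
  cases h with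
  | mem i => exact e
  | out k => cases e
  | comp g => obtain ⟨i, hi⟩ | ⟨g, -, hg⟩ := mem_opPreds e <;> contradiction
  | copy g => cases e

theorem eq_copy_of_circuitEdge_comp {g : N.Gate} {h : NetGate n ℓ m N.Gate}
    (e : N.circuitEdge out (.comp g) h) : h = .copy g := by
  cases h with
  | mem i => exact e.elim
  | out k => cases e
  | comp g => obtain ⟨i, hi⟩ | ⟨g, -, hg⟩ := mem_opPreds e <;> contradiction
  | copy g => cases e; rfl

theorem circuitLabel_eq_func {g : NetGate n ℓ m N.Gate} {f : ℝ → ℝ}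
    (h : N.circuitLabel g = .func f) : ∃ g' h', g = .comp g' ∧ N.op g' = .func f h' := by
  cases g with
  | comp g =>
    obtain ⟨h', hop⟩ := exists_eq_func_of_opLabel_eq h
    exact ⟨g, h', rfl, hop⟩
  | mem i => cases i <;> cases h
  | _ => cases h

theorem circuitLabel_eq_input_iff (g : NetGate n ℓ m N.Gate) (j : Fin n) :
    N.circuitLabel g = .input j ↔ g = .mem (.inl j) := by
  cases g with
  | mem i => cases i <;> simp [circuitLabel]
  | comp g => cases hop : N.op g <;> simp [circuitLabel, hop, opLabel]
  | _ => simp [circuitLabel]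

theorem circuitLabel_eq_aux_iff (g : NetGate n ℓ m N.Gate) (j : Fin ℓ) :
    N.circuitLabel g = .aux j ↔ g = .mem (.inr j) := by
  cases g with
  | mem i => cases i <;> simp [circuitLabel]
  | comp g => cases hop : N.op g <;> simp [circuitLabel, hop, opLabel]
  | _ => simp [circuitLabel]

theorem circuitLabel_eq_output_iff (g : NetGate n ℓ m N.Gate) (j : Fin m) :
    N.circuitLabel g = .output j ↔ g = .out j := by
  cases g with
  | mem i => cases i <;> simp [circuitLabel]
  | comp g => cases hop : N.op g <;> simp [circuitLabel, hop, opLabel]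
  | _ => simp [circuitLabel]

theorem not_circuitEdge_of_const {g : NetGate n ℓ m N.Gate} {c : ℝ}
    (hg : N.circuitLabel g = .const c) (h : NetGate n ℓ m N.Gate) : ¬ N.circuitEdge out h g := by
  cases g with
  | comp g => cases hop : N.op g <;>
      simp_all [circuitLabel, opLabel, circuitEdge, opPreds, NetOp.preds]
  | mem i => exact id
  | _ => cases hg

/-- The circuit of a net. -/
abbrev toCircuit : ExtCircuit n ℓ m where
  Gate := NetGate n ℓ m N.Gate
  label := N.circuitLabel
  edge := N.circuitEdge out
  acyclic := N.acyclic_circuitEdge out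
  inGate j := .mem (.inl j)
  auxGate j := .mem (.inr j)
  outGate := .out
  label_eq_input := N.circuitLabel_eq_input_iff
  label_eq_aux := N.circuitLabel_eq_aux_iff
  label_eq_output := N.circuitLabel_eq_output_iff
  input_source _ _ := id
  aux_source _ _ := id
  const_source _ _ := N.not_circuitEdge_of_const out
  output_indeg _ := ⟨_, rfl, fun _ h => h⟩
  output_outdeg := N.not_circuitEdge_out out
  func_indeg g f hg := by
    obtain ⟨g', h', rfl, hop⟩ := N.circuitLabel_eq_func hg
    simpa only [circuitEdge, hop, mem_opPreds_func] using existsUnique_eq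
  func_outdeg g f hg := by
    obtain ⟨g', h', rfl, -⟩ := N.circuitLabel_eq_func hg
    exact ⟨.copy g', rfl, fun h => N.eq_copy_of_circuitEdge_comp out⟩

theorem toCircuit_gatesIn : (N.toCircuit out).GatesIn B := fun g f hg => by
  obtain ⟨g', h', rfl, hop⟩ := N.circuitLabel_eq_func hg
  exact N.func_mem g' f h' hop

theorem size_toCircuit : (N.toCircuit out).size = n + ℓ + m + 2 * Fintype.card N.Gate :=
  NetGate.card_eq n ℓ m N.Gate

theorem depth_toCircuit_le : (N.toCircuit out).depth ≤ 2 * N.depth + 3 :=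
  ExtCircuit.depth_le_of_rank N.circuitRank (fun _ _ => N.circuitRank_lt out) N.circuitRank_le

variable (x : Fin n → ℝ) (a : Fin ℓ → ℝ)

theorem value_toCircuit_copy (g : N.Gate) :
    (N.toCircuit out).value x a (.copy g) = (N.toCircuit out).value x a (.comp g) :=
  (ExtCircuit.value_of_add (S := {.comp g}) rfl fun _ => Finset.mem_singleton).trans
    (Finset.sum_singleton ..)

theorem value_toCircuit_mem (i : Fin n ⊕ Fin ℓ) :
    (N.toCircuit out).value x a (.mem i) = Sum.elim x a i := by
  cases i with
  | inl j => exact ExtCircuit.value_of_input rfl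
  | inr j => exact ExtCircuit.value_of_aux rfl

theorem value_toCircuit_comp (g : N.Gate) :
    (N.toCircuit out).value x a (.comp g) =
      (N.op g).eval (Sum.elim x a) fun h => (N.toCircuit out).value x a (.comp h) := by
  simp only [← N.value_toCircuit_copy out]
  have hlabel : (N.toCircuit out).label (.comp g) = opLabel (N.op g) := rfl
  have hedge : ∀ h, h ∈ opPreds (N.op g) ↔ (N.toCircuit out).edge h (.comp g) := fun h => Iff.rfl
  cases hop : N.op g with rw [hop] at hlabel hedge
  | input i =>
    rw [value_toCircuit_copy, ExtCircuit.value_of_add hlabel hedge]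
    exact (Finset.sum_singleton ..).trans (N.value_toCircuit_mem out x a i)
  | const c => rw [value_toCircuit_copy, ExtCircuit.value_of_const hlabel]; rfl
  | add S =>
    rw [value_toCircuit_copy, ExtCircuit.value_of_add hlabel hedge]
    exact Finset.sum_map ..
  | mul S =>
    rw [value_toCircuit_copy, ExtCircuit.value_of_mul hlabel hedge]
    exact Finset.prod_map ..
  | func f h =>
    rw [value_toCircuit_copy]
    exact ExtCircuit.value_of_func hlabel fun h' => (hedge h').symm.trans mem_opPreds_func

variable {N x a}

theorem IsValuation.value_toCircuit_copy {v : N.Gate → ℝ} (hv : N.IsValuation (Sum.elim x a) v)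
    (g : N.Gate) : (N.toCircuit out).value x a (.copy g) = v g := by
  induction hr : N.rank g using Nat.strong_induction_on generalizing g with
  | _ r ih =>
    have hpreds : ∀ h ∈ (N.op g).preds, (N.toCircuit out).value x a (.comp h) = v h :=
      fun h hh => (N.value_toCircuit_copy out x a h).symm.trans
        (ih _ (hr ▸ N.rank_lt g h hh) h rfl)
    rw [Net.value_toCircuit_copy, value_toCircuit_comp, hv g]
    exact NetOp.eval_congr hpreds

theorem eval_toCircuit (j : Fin m) :
    (N.toCircuit out).eval x a j = (N.toCircuit out).value x a (.copy (out j)) :=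
  ExtCircuit.value_of_output (C := N.toCircuit out) (j := j) rfl fun _ => Iff.rfl

end Net

theorem exists_circuit {B : Set (ℝ → ℝ)} {n ℓ m : ℕ} {O : Type} [Fintype O]
    {f : O → (Fin n ⊕ Fin ℓ → ℝ) → ℝ} {s d : ℕ} (hf : ∀ o, NetComputable B (f o) s d)
    (out : Fin m → O) :
    ∃ (C : ExtCircuit n ℓ m) (gate : O → C.Gate),
      (∀ o j, gate o ≠ C.outGate j) ∧
      (∀ x a o, C.value x a (gate o) = f o (Sum.elim x a)) ∧
      (∀ x a j, C.eval x a j = f (out j) (Sum.elim x a)) ∧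
      C.GatesIn B ∧ C.size ≤ n + ℓ + m + 2 * (Fintype.card O * s) ∧ C.depth ≤ 2 * d + 3 := by
  obtain ⟨N, q, hN, hsize, hdepth⟩ := NetComputable.exists_net hf
  let C := N.toCircuit (q ∘ out)
  have hval : ∀ x a o, C.value x a (.copy (q o)) = f o (Sum.elim x a) := by
    intro x a o
    obtain ⟨v, hv, hvq⟩ := hN (Sum.elim x a)
    rw [hv.value_toCircuit_copy, hvq]
  refine ⟨C, fun o => .copy (q o), fun o j => nofun, hval, fun x a j => ?_,
    N.toCircuit_gatesIn _, ?_, (N.depth_toCircuit_le _).trans (by lia)⟩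
  · exact (Net.eval_toCircuit _ j).trans (hval x a (out j))
  · exact (N.size_toCircuit _).trans_le (by lia)

/-! ### Uniform polynomial bounds -/

/-- The quantity `c` is polynomially bounded in the weight `w`, uniformly in the parameter. -/
def PolyBdd {P : Type*} (w c : P → ℕ) : Prop := ∃ a k, ∀ p, c p ≤ a * (w p + 1) ^ k

theorem mul_succ_pow_mono {a a' k k' : ℕ} (ha : a ≤ a') (hk : k ≤ k') (x : ℕ) :
    a * (x + 1) ^ k ≤ a' * (x + 1) ^ k' :=
  Nat.mul_le_mul ha (Nat.pow_le_pow_right (Nat.succ_pos x) hk)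

theorem le_sum_univ {ι : Type*} [Fintype ι] (u : ι → ℕ) (i : ι) : u i ≤ ∑ j, u j :=
  Finset.single_le_sum (fun _ _ => Nat.zero_le _) (Finset.mem_univ i)

namespace PolyBdd

variable {P : Type*} {w c c' : P → ℕ}

theorem mono (h : PolyBdd w c') (hc : ∀ p, c p ≤ c' p) : PolyBdd w c := by
  obtain ⟨a, k, h⟩ := h
  exact ⟨a, k, fun p => (hc p).trans (h p)⟩

theorem reindex {P' : Type} (q : P' → P) (h : PolyBdd w c) :
    PolyBdd (fun p => w (q p)) (fun p => c (q p)) := by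
  obtain ⟨a, k, h⟩ := h
  exact ⟨a, k, fun p => h (q p)⟩

theorem const (a : ℕ) : PolyBdd w fun _ => a := ⟨a, 0, fun p => by simp⟩

theorem self : PolyBdd w w := ⟨1, 1, fun p => by simp⟩

theorem add (h : PolyBdd w c) (h' : PolyBdd w c') : PolyBdd w fun p => c p + c' p := by
  obtain ⟨a, k, h⟩ := h
  obtain ⟨a', k', h'⟩ := h'
  refine ⟨a + a', k + k', fun p => ?_⟩
  rw [add_mul]
  exact Nat.add_le_add ((h p).trans (mul_succ_pow_mono le_rfl (Nat.le_add_right ..) _))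
    ((h' p).trans (mul_succ_pow_mono le_rfl (Nat.le_add_left ..) _))

theorem mul (h : PolyBdd w c) (h' : PolyBdd w c') : PolyBdd w fun p => c p * c' p := by
  obtain ⟨a, k, h⟩ := h
  obtain ⟨a', k', h'⟩ := h'
  refine ⟨a * a', k + k', fun p => ?_⟩
  rw [pow_add, mul_mul_mul_comm]
  exact Nat.mul_le_mul (h p) (h' p)

theorem trans {w' : P → ℕ} (h : PolyBdd w c) (h' : PolyBdd w' w) : PolyBdd w' c := by
  obtain ⟨a, k, h⟩ := h
  obtain ⟨a', k', h'⟩ := h'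
  refine ⟨a * (a' + 1) ^ k, k' * k, fun p => ?_⟩
  have hw : w p + 1 ≤ (a' + 1) * (w' p + 1) ^ k' := by
    rw [add_mul, one_mul]
    exact Nat.add_le_add (h' p) (Nat.one_le_pow _ _ (Nat.succ_pos _))
  calc c p ≤ a * (w p + 1) ^ k := h p
    _ ≤ a * ((a' + 1) * (w' p + 1) ^ k') ^ k := by gcongr
    _ = a * (a' + 1) ^ k * (w' p + 1) ^ (k' * k) := by rw [mul_pow, pow_mul, mul_assoc]

theorem sum {J : P → Type} [∀ p, Fintype (J p)] {b : ∀ p, J p → ℕ}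
    (hJ : PolyBdd w fun p => Fintype.card (J p))
    (hb : PolyBdd (fun q : Σ p, J p => w q.1) fun q => b q.1 q.2) :
    PolyBdd w fun p => ∑ j, b p j := by
  obtain ⟨a, k, hb⟩ := hb
  refine (hJ.mul (c' := fun p => a * (w p + 1) ^ k) ⟨a, k, fun _ => le_rfl⟩).mono fun p => ?_
  calc ∑ j, b p j ≤ ∑ _j : J p, a * (w p + 1) ^ k := Finset.sum_le_sum fun j _ => hb ⟨p, j⟩
    _ = Fintype.card (J p) * (a * (w p + 1) ^ k) := by simp

theorem sigma {ι : Type} [Finite ι] {P : ι → Type} {w c : ∀ i, P i → ℕ}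
    (h : ∀ i, PolyBdd (w i) (c i)) :
    PolyBdd (fun q : Σ i, P i => w q.1 q.2) (fun q => c q.1 q.2) := by
  cases nonempty_fintype ι
  choose a k h using h
  exact ⟨∑ i, a i, ∑ i, k i, fun q => (h q.1 q.2).trans
    (mul_succ_pow_mono (le_sum_univ a q.1) (le_sum_univ k q.1) _)⟩

end PolyBdd

/-- The binary length of `n + 1`, the discrete counterpart of `log n`; it is positive also for
`n ≤ 1`. -/
def binLen (n : ℕ) : ℕ := Nat.size (n + 1)

theorem binLen_le_iff {n t : ℕ} : binLen n ≤ t ↔ n + 1 < 2 ^ t := Nat.size_le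

theorem binLen_pos (n : ℕ) : 0 < binLen n := Nat.size_pos.2 (Nat.succ_pos n)

theorem lt_two_pow_binLen (n : ℕ) : n + 1 < 2 ^ binLen n := Nat.lt_size_self _

theorem binLen_mono {n n' : ℕ} (h : n ≤ n') : binLen n ≤ binLen n' :=
  Nat.size_le_size (Nat.succ_le_succ h)

theorem binLen_mul_succ_pow_le (a k n : ℕ) :
    binLen (a * (n + 1) ^ k) ≤ (binLen a + k) * binLen n := by
  have hlt : a * (n + 1) ^ k + 1 < 2 ^ (binLen a + binLen n * k) := by
    calc a * (n + 1) ^ k + 1 ≤ (a + 1) * (n + 1) ^ k := by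
          rw [add_mul, one_mul]
          exact Nat.add_le_add_left (Nat.one_le_pow _ _ (Nat.succ_pos _)) _
      _ < 2 ^ binLen a * (2 ^ binLen n) ^ k :=
          Nat.mul_lt_mul_of_lt_of_le (lt_two_pow_binLen a)
            (Nat.pow_le_pow_left (lt_two_pow_binLen n).le k) (by positivity)
      _ = 2 ^ (binLen a + binLen n * k) := by rw [pow_add, pow_mul]
  calc binLen (a * (n + 1) ^ k) ≤ binLen a + binLen n * k := binLen_le_iff.2 hlt
    _ ≤ binLen a * binLen n + k * binLen n :=
        Nat.add_le_add (Nat.le_mul_of_pos_right _ (binLen_pos n)) (mul_comm _ _).le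
    _ = (binLen a + k) * binLen n := (add_mul ..).symm

/-- The arithmetic conditional: `y` if `c = 0`, and `z` if `c = 1`. -/
def select (c y z : ℝ) : ℝ := (1 - c) * y + c * z

theorem select_zero (y z : ℝ) : select 0 y z = y := by simp [select]

theorem select_one (y z : ℝ) : select 1 y z = z := by simp [select]

/-! ### Feasible families of functions -/

/-- The functions `f p` are computed by nets over the gates of `F` of size polynomial in the weight
`w p` and of depth `O((log (w p))^i)`, uniformly in the parameter `p`. This is the nonuniform
circuit class `F`, but with an arbitrary index set in place of the input lengths. -/
def Feasible (F : CircuitClass) {P : Type} (w : P → ℕ) {I : P → Type}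
    (f : ∀ p, (I p → ℝ) → ℝ) : Prop :=
  ∃ a k b, ∀ p,
    NetComputable F.gates (f p) (a * (w p + 1) ^ k) (b * binLen (w p) ^ F.exponent)

namespace Feasible

variable {F : CircuitClass} {P : Type} {w : P → ℕ} {I : P → Type}

theorem of_bound {f : ∀ p, (I p → ℝ) → ℝ} {s d : P → ℕ} (hs : PolyBdd w s)
    (hd : ∃ b, ∀ p, d p ≤ b * binLen (w p) ^ F.exponent)
    (h : ∀ p, NetComputable F.gates (f p) (s p) (d p)) : Feasible F w f := by
  obtain ⟨a, k, hs⟩ := hs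
  obtain ⟨b, hd⟩ := hd
  exact ⟨a, k, b, fun p => (h p).mono (hs p) (hd p)⟩

theorem of_depth_le_const {f : ∀ p, (I p → ℝ) → ℝ} {s : P → ℕ} {d : ℕ} (hs : PolyBdd w s)
    (h : ∀ p, NetComputable F.gates (f p) (s p) d) : Feasible F w f :=
  of_bound hs ⟨d, fun _ => Nat.le_mul_of_pos_right _ (Nat.pow_pos (binLen_pos _))⟩ h

theorem reindex {P' : Type} {f : ∀ p, (I p → ℝ) → ℝ} (q : P' → P) (h : Feasible F w f) :
    Feasible F (fun p => w (q p)) (fun p => f (q p)) := by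
  obtain ⟨a, k, b, h⟩ := h
  exact ⟨a, k, b, fun p => h (q p)⟩

theorem rename {I' : P → Type} {f : ∀ p, (I p → ℝ) → ℝ} (h : Feasible F w f)
    (r : ∀ p, I p → I' p) : Feasible F w fun p x => f p (x ∘ r p) := by
  obtain ⟨a, k, b, h⟩ := h
  exact ⟨a, k, b, fun p => (h p).rename (r p)⟩

theorem reweight {w' : P → ℕ} {f : ∀ p, (I p → ℝ) → ℝ} (h : Feasible F w f)
    (hw : PolyBdd w' w) : Feasible F w' f := by
  obtain ⟨a, k, b, h⟩ := h
  obtain ⟨a', k', hw'⟩ := id hw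
  refine of_bound (.trans ⟨a, k, fun _ => le_rfl⟩ hw)
    ⟨b * (binLen a' + k') ^ F.exponent, fun p => ?_⟩ h
  have hlen : binLen (w p) ≤ (binLen a' + k') * binLen (w' p) :=
    (binLen_mono (hw' p)).trans (binLen_mul_succ_pow_le ..)
  calc b * binLen (w p) ^ F.exponent ≤ b * ((binLen a' + k') * binLen (w' p)) ^ F.exponent := by
        gcongr
    _ = b * (binLen a' + k') ^ F.exponent * binLen (w' p) ^ F.exponent := by
        rw [mul_pow, mul_assoc]

theorem sigma {ι : Type} [Finite ι] {P : ι → Type} {w : ∀ i, P i → ℕ} {I : ∀ i, P i → Type}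
    {f : ∀ i p, (I i p → ℝ) → ℝ} (h : ∀ i, Feasible F (w i) (f i)) :
    Feasible F (fun q : Σ i, P i => w q.1 q.2) (fun q => f q.1 q.2) := by
  cases nonempty_fintype ι
  choose a k b h using h
  exact ⟨∑ i, a i, ∑ i, k i, ∑ i, b i, fun q => (h q.1 q.2).mono
    (mul_succ_pow_mono (le_sum_univ a q.1) (le_sum_univ k q.1) _)
    (Nat.mul_le_mul_right _ (le_sum_univ b q.1))⟩

theorem of_cover {P₁ P₂ : Type} {f : ∀ p, (I p → ℝ) → ℝ} (q₁ : P₁ → P) (q₂ : P₂ → P)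
    (h₁ : Feasible F (fun p => w (q₁ p)) fun p => f (q₁ p))
    (h₂ : Feasible F (fun p => w (q₂ p)) fun p => f (q₂ p))
    (hcover : ∀ p, (∃ p', q₁ p' = p) ∨ ∃ p', q₂ p' = p) : Feasible F w f := by
  obtain ⟨a, k, b, h₁⟩ := h₁
  obtain ⟨a', k', b', h₂⟩ := h₂
  refine ⟨a + a', k + k', b + b', fun p => ?_⟩
  obtain ⟨p, rfl⟩ | ⟨p, rfl⟩ := hcover p
  · exact (h₁ p).mono (mul_succ_pow_mono (Nat.le_add_right ..) (Nat.le_add_right ..) _)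
      (Nat.mul_le_mul_right _ (Nat.le_add_right ..))
  · exact (h₂ p).mono (mul_succ_pow_mono (Nat.le_add_left ..) (Nat.le_add_left ..) _)
      (Nat.mul_le_mul_right _ (Nat.le_add_left ..))

theorem sigma_sum {J K : P → Type} {f : ∀ q : Σ p, J p ⊕ K p, (I q.1 → ℝ) → ℝ}
    (h₁ : Feasible F (fun q : Σ p, J p => w q.1) fun q => f ⟨q.1, .inl q.2⟩)
    (h₂ : Feasible F (fun q : Σ p, K p => w q.1) fun q => f ⟨q.1, .inr q.2⟩) :
    Feasible F (fun q : Σ p, J p ⊕ K p => w q.1) f :=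
  of_cover (fun q : Σ p, J p => ⟨q.1, .inl q.2⟩) (fun q : Σ p, K p => ⟨q.1, .inr q.2⟩) h₁ h₂ <| by
    rintro ⟨p, j | k⟩
    · exact .inl ⟨⟨p, j⟩, rfl⟩
    · exact .inr ⟨⟨p, k⟩, rfl⟩

theorem sigma_fin {r : P → ℕ} {f : ∀ q : Σ p, Fin (r p + 1), (I q.1 → ℝ) → ℝ}
    (h₁ : Feasible F w fun p => f ⟨p, 0⟩)
    (h₂ : Feasible F (fun q : Σ p, Fin (r p) => w q.1) fun q => f ⟨q.1, q.2.succ⟩) :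
    Feasible F (fun q : Σ p, Fin (r p + 1) => w q.1) f :=
  of_cover (fun p => ⟨p, 0⟩) (fun q : Σ p, Fin (r p) => ⟨q.1, q.2.succ⟩) h₁ h₂ <| by
    rintro ⟨p, j⟩
    cases j using Fin.cases with
    | zero => exact .inl ⟨p, rfl⟩
    | succ j => exact .inr ⟨⟨p, j⟩, rfl⟩

theorem sigma_bool {f g : ∀ p, (I p → ℝ) → ℝ} (hf : Feasible F w f) (hg : Feasible F w g) :
    Feasible F (fun q : Σ _ : P, Bool => w q.1) fun q => cond q.2 (f q.1) (g q.1) :=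
  of_cover (fun p => ⟨p, true⟩) (fun p => ⟨p, false⟩) hf hg <| by
    rintro ⟨p, _ | _⟩
    · exact .inr ⟨p, rfl⟩
    · exact .inl ⟨p, rfl⟩

theorem var (i : ∀ p, I p) : Feasible F w fun p (x : I p → ℝ) => x (i p) :=
  of_depth_le_const (.const 2) fun p => .var (i p)

theorem const (c : P → ℝ) : Feasible F w fun p (_ : I p → ℝ) => c p :=
  of_depth_le_const (.const 1) fun p => .const (c p)

theorem subst {M : P → Type} [∀ p, Fintype (M p)] {f : ∀ p, (M p → ℝ) → ℝ}
    {g : ∀ p, M p → (I p → ℝ) → ℝ} (hf : Feasible F w f)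
    (hg : Feasible F (fun q : Σ p, M p => w q.1) fun q => g q.1 q.2)
    (hM : PolyBdd w fun p => Fintype.card (M p)) :
    Feasible F w fun p x => f p fun m => g p m x := by
  obtain ⟨a, k, b, hf⟩ := hf
  obtain ⟨a', k', b', hg⟩ := hg
  have hsize : PolyBdd w fun p =>
      a * (w p + 1) ^ k + Fintype.card (M p) * (a' * (w p + 1) ^ k') :=
    .add ⟨a, k, fun _ => le_rfl⟩ (hM.mul ⟨a', k', fun _ => le_rfl⟩)
  refine of_bound (d := fun p =>
    b * binLen (w p) ^ F.exponent + b' * binLen (w p) ^ F.exponent + 1) hsize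
    ⟨b + b' + 1, fun p => ?_⟩ fun p => (hf p).subst fun m => hg ⟨p, m⟩
  rw [add_mul, add_mul, one_mul]
  exact Nat.add_le_add_left (Nat.pow_pos (binLen_pos _)) _

theorem sum {J : P → Type} [∀ p, Fintype (J p)] {f : ∀ p, J p → (I p → ℝ) → ℝ}
    (hf : Feasible F (fun q : Σ p, J p => w q.1) fun q => f q.1 q.2)
    (hJ : PolyBdd w fun p => Fintype.card (J p)) :
    Feasible F w fun p x => ∑ j, f p j x :=
  subst (of_depth_le_const (hJ.add (.const 1)) fun _ => .sum) hf hJ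

theorem prod {J : P → Type} [∀ p, Fintype (J p)] {f : ∀ p, J p → (I p → ℝ) → ℝ}
    (hf : Feasible F (fun q : Σ p, J p => w q.1) fun q => f q.1 q.2)
    (hJ : PolyBdd w fun p => Fintype.card (J p)) :
    Feasible F w fun p x => ∏ j, f p j x :=
  subst (of_depth_le_const (hJ.add (.const 1)) fun _ => .prod) hf hJ

theorem add {f g : ∀ p, (I p → ℝ) → ℝ} (hf : Feasible F w f) (hg : Feasible F w g) :
    Feasible F w fun p x => f p x + g p x := by
  simpa using sum (f := fun p (t : Bool) => cond t (f p) (g p)) (hf.sigma_bool hg) (.const 2)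

theorem mul {f g : ∀ p, (I p → ℝ) → ℝ} (hf : Feasible F w f) (hg : Feasible F w g) :
    Feasible F w fun p x => f p x * g p x := by
  simpa using prod (f := fun p (t : Bool) => cond t (f p) (g p)) (hf.sigma_bool hg) (.const 2)

theorem sub {f g : ∀ p, (I p → ℝ) → ℝ} (hf : Feasible F w f) (hg : Feasible F w g) :
    Feasible F w fun p x => f p x - g p x := by
  simpa [sub_eq_add_neg] using hf.add ((const fun _ => -1).mul hg)

theorem func {σ : P → ℝ → ℝ} {f : ∀ p, (I p → ℝ) → ℝ} (hσ : ∀ p, σ p ∈ F.gates)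
    (hf : Feasible F w f) : Feasible F w fun p x => σ p (f p x) :=
  subst (M := fun _ => Unit) (f := fun p y => σ p (y ())) (g := fun p _ => f p)
    (of_depth_le_const (.const 2) fun p => .func (hσ p))
    (hf.reindex fun q : Σ _ : P, Unit => q.1) (.const 1)

theorem select {c f g : ∀ p, (I p → ℝ) → ℝ} (hc : Feasible F w c) (hf : Feasible F w f)
    (hg : Feasible F w g) : Feasible F w fun p x => select (c p x) (f p x) (g p x) :=
  (((const fun _ => 1).sub hc).mul hf).add (hc.mul hg)

end Feasible

/-! ### Circuit families -/

section Asymptotics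

open Asymptotics Filter

theorem isBigO_natCast_iff {s t : ℕ → ℕ} (ht : ∀ n, 0 < t n) :
    ((fun n => (s n : ℝ)) =O[atTop] fun n => (t n : ℝ)) ↔ ∃ a, ∀ n, s n ≤ a * t n := by
  constructor
  · intro h
    obtain ⟨c, -, hc⟩ := bound_of_isBigO_nat_atTop h
    refine ⟨⌈c⌉₊, fun n => ?_⟩
    have hst : (s n : ℝ) ≤ c * t n := by
      simpa using hc (x := n) (Nat.cast_ne_zero.2 (ht n).ne')
    exact_mod_cast hst.trans (mul_le_mul_of_nonneg_right (Nat.le_ceil c) (Nat.cast_nonneg _))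
  · rintro ⟨a, ha⟩
    refine .of_bound a (.of_forall fun n => ?_)
    simpa using (Nat.cast_le (α := ℝ)).2 (ha n)

theorem isTheta_succ_pow (k : ℕ) :
    (fun n : ℕ => (((n + 1) ^ k : ℕ) : ℝ)) =Θ[atTop] fun n : ℕ => (n : ℝ) ^ k := by
  have hsucc : (fun n : ℕ => ((n + 1 : ℕ) : ℝ)) =Θ[atTop] fun n : ℕ => (n : ℝ) := by
    refine ⟨.of_bound 2 ?_, .of_bound 1 (.of_forall fun n => ?_)⟩
    · filter_upwards [eventually_ge_atTop 1] with n hn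
      have hle : n + 1 ≤ 2 * n := by lia
      simpa only [Real.norm_natCast] using mod_cast hle
    · simpa only [Real.norm_natCast, one_mul] using mod_cast n.le_succ
  simpa only [Nat.cast_pow] using hsucc.pow k

theorem log_le_binLen (n : ℕ) : Real.log n ≤ binLen n := by
  obtain rfl | hn := n.eq_zero_or_pos
  · simp
  have hpow : n ≤ 2 ^ binLen n := n.le_succ.trans (lt_two_pow_binLen n).le
  calc Real.log n ≤ Real.log (2 ^ binLen n) :=
        Real.log_le_log (mod_cast hn) (mod_cast hpow)
    _ = binLen n * Real.log 2 := Real.log_pow ..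
    _ ≤ binLen n := mul_le_of_le_one_right (Nat.cast_nonneg _) (by linarith [Real.log_two_lt_d9])

theorem binLen_le_log {n : ℕ} (hn : 2 ≤ n) : (binLen n : ℝ) ≤ 6 * Real.log n := by
  have hhalf : 2 ^ (binLen n - 1) ≤ n + 1 := Nat.lt_size.1 (Nat.sub_lt (binLen_pos n) one_pos)
  have hpow : 2 ^ binLen n ≤ n ^ 3 := by
    rw [← Nat.sub_add_cancel (binLen_pos n), pow_succ]
    nlinarith [Nat.mul_le_mul hn hn]
  have hlog : binLen n * Real.log 2 ≤ 3 * Real.log n := by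
    have hpow' : (2 : ℝ) ^ binLen n ≤ (n : ℝ) ^ 3 := mod_cast hpow
    simpa only [Real.log_pow, Nat.cast_ofNat] using Real.log_le_log (by positivity) hpow'
  nlinarith [Real.log_two_gt_d9, (binLen n).cast_nonneg (α := ℝ)]

theorem isTheta_binLen_log :
    (fun n => (binLen n : ℝ)) =Θ[atTop] fun n : ℕ => Real.log n := by
  refine ⟨.of_bound 6 ?_, .of_bound 1 (.of_forall fun n => ?_)⟩
  · filter_upwards [eventually_ge_atTop 2] with n hn
    simpa only [Real.norm_natCast, Real.norm_of_nonneg (Real.log_natCast_nonneg n)]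
      using binLen_le_log hn
  · simpa only [Real.norm_natCast, Real.norm_of_nonneg (Real.log_natCast_nonneg n), one_mul]
      using log_le_binLen n

theorem exists_isBigO_pow_iff {s : ℕ → ℕ} :
    (∃ k : ℕ, (fun n => (s n : ℝ)) =O[atTop] fun n : ℕ => (n : ℝ) ^ k) ↔ PolyBdd id s := by
  simp only [← (isTheta_succ_pow _).isBigO_congr_right, PolyBdd, id_eq,
    isBigO_natCast_iff fun n => Nat.pow_pos n.succ_pos]
  exact exists_comm

theorem isBigO_log_pow_iff {s : ℕ → ℕ} {e : ℕ} :
    ((fun n => (s n : ℝ)) =O[atTop] fun n : ℕ => Real.log n ^ e) ↔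
      ∃ b, ∀ n, s n ≤ b * binLen n ^ e := by
  rw [← isBigO_natCast_iff fun n => Nat.pow_pos (binLen_pos n),
    ← (isTheta_binLen_log.pow e).isBigO_congr_right]
  simp only [Nat.cast_pow]

end Asymptotics

theorem isFamily_iff {F : CircuitClass} {ℓ m : ℕ → ℕ} {C : ∀ n, ExtCircuit n (ℓ n) (m n)} :
    F.IsFamily C ↔ (∀ n, (C n).GatesIn F.gates) ∧ (PolyBdd id fun n => (C n).size) ∧
      ∃ b, ∀ n, (C n).depth ≤ b * binLen n ^ F.exponent :=
  and_congr_right fun _ => and_congr exists_isBigO_pow_iff isBigO_log_pow_iff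

theorem feasible_value {F : CircuitClass} {ℓ m : ℕ → ℕ} {C : ∀ n, ExtCircuit n (ℓ n) (m n)}
    (h : F.IsFamily C) :
    Feasible F (fun q : Σ n, (C n).Gate => q.1) (I := fun q => Fin q.1 ⊕ Fin (ℓ q.1))
      fun q s => (C q.1).value (s ∘ Sum.inl) (s ∘ Sum.inr) q.2 := by
  obtain ⟨hgates, hsize, b, hdepth⟩ := isFamily_iff.1 h
  exact .of_bound (hsize.reindex Sigma.fst) ⟨b, fun q => hdepth q.1⟩
    fun q => (C q.1).netComputable_value q.2 (hgates q.1)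

theorem feasible_eval {F : CircuitClass} {D : ∀ n, Circuit n 1} (h : F.IsFamily D) :
    Feasible F (fun n : ℕ => n) fun n x => (D n).eval x Fin.elim0 0 := by
  have hrename := ((feasible_value h).reindex fun n => ⟨n, (D n).outGate 0⟩).rename
    fun _ => Sum.elim id Fin.elim0
  convert hrename using 3 with n x
  exact congrArg (fun a => (D n).value x a _) (Subsingleton.elim _ _)

theorem exists_isFamily_of_feasible {F : CircuitClass} {f : ∀ n : ℕ, (Fin n → ℝ) → ℝ}
    (hf : Feasible F (fun n : ℕ => n) f) :
    ∃ D : ∀ n, Circuit n 1, F.IsFamily D ∧ ∀ n x, (D n).eval x Fin.elim0 0 = f n x := by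
  have hf' : Feasible F (fun n : ℕ => n) (I := fun n => Fin n ⊕ Fin 0)
      fun n x => f n fun j => x (.inl j) :=
    hf.subst (.var fun q : Σ n : ℕ, Fin n => Sum.inl q.2) (by simpa using PolyBdd.self)
  obtain ⟨a, k, b, hcomp⟩ := hf'
  choose D gate _ _ heval hgates hsize hdepth using fun n =>
    exists_circuit (O := Unit) (m := 1) (fun _ => hcomp n) fun _ => ()
  refine ⟨D, isFamily_iff.2 ⟨hgates, PolyBdd.mono ?_ hsize, 2 * b + 3, fun n =>
    (hdepth n).trans ?_⟩, fun n x => heval n x Fin.elim0 0⟩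
  · exact ((PolyBdd.self.add (.const 0)).add (.const 1)).add
      ((PolyBdd.const 2).mul ((PolyBdd.const _).mul ⟨a, k, fun _ => le_rfl⟩))
  · have hpos : 1 ≤ binLen n ^ F.exponent := Nat.pow_pos (binLen_pos n)
    linarith

theorem isFamily_mono {F F' : CircuitClass} (hexp : F.exponent = F'.exponent)
    (hgates : F.gates ⊆ F'.gates) {ℓ m : ℕ → ℕ} {C : ∀ n, ExtCircuit n (ℓ n) (m n)}
    (h : F.IsFamily C) : F'.IsFamily C :=
  ⟨fun n g f hg => hgates (h.1 n g f hg), h.2.1, hexp ▸ h.2.2⟩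

theorem recClass_mono {E E' F F' : CircuitClass} (hE : E.exponent = E'.exponent)
    (hE' : E.gates ⊆ E'.gates) (hF : F.exponent = F'.exponent) (hF' : F.gates ⊆ F'.gates) :
    recClass E F ⊆ recClass E' F' := by
  rintro f ⟨R, hfam, ⟨D, hD, hhalt⟩, rfl⟩
  exact ⟨R, isFamily_mono hF hF' hfam, ⟨D, isFamily_mono hE hE' hD, hhalt⟩, rfl⟩

/-! ### Recurrent circuits from dynamical systems -/

theorem mem_assert_find_iff {α : Type*} {p : ℕ → Prop} [DecidablePred p] {g : ℕ → Part α} {y : α} :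
    (y ∈ Part.assert (∃ k, p k) fun h => g (Nat.find h)) ↔
      ∃ k, p k ∧ (∀ j < k, ¬ p j) ∧ y ∈ g k := by
  rw [Part.mem_assert_iff]
  constructor
  · rintro ⟨h, hy⟩
    exact ⟨Nat.find h, Nat.find_spec h, fun _ => Nat.find_min h, hy⟩
  · rintro ⟨k, hk, hmin, hy⟩
    exact ⟨⟨k, hk⟩, by rwa [(Nat.find_eq_iff ⟨k, hk⟩).2 ⟨hk, hmin⟩]⟩

open Classical in
theorem RecCircuit.mem_eval_iff {n m : ℕ} {R : RecCircuit n m} {x : Fin n → ℝ} {y : Fin m → ℝ} :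
    y ∈ R.eval x ↔ ∃ k, R.HaltsAt x k ∧ (∀ j < k, ¬ R.HaltsAt x j) ∧
      y = R.circ.eval (R.memory x k).1 (R.memory x k).2 := by
  simp only [RecCircuit.eval, ← Part.mem_some_iff]
  exact mem_assert_find_iff (p := R.HaltsAt x)
    (g := fun k => Part.some (R.circ.eval (R.memory x k).1 (R.memory x k).2))

/-- A dynamical system on real vectors that computes a partial function: the state consists of
coordinates `X`, which hold the input at the start, and of auxiliary coordinates `Y`, which start
with the values `init`; the result, with coordinates `Z`, is read off from the first state whose
halting value is positive. This is a recurrent circuit without the circuit. -/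
structure RealSystem (X Y Z : Type) where
  init : Y → ℝ
  next : (X ⊕ Y → ℝ) → X ⊕ Y → ℝ
  result : (X ⊕ Y → ℝ) → Z → ℝ
  haltValue : (X ⊕ Y → ℝ) → ℝ

namespace RealSystem

variable {X Y Z : Type} (S : RealSystem X Y Z)

/-- The state after `t` iterations on input `x`. -/
def state (x : X → ℝ) (t : ℕ) : X ⊕ Y → ℝ := S.next^[t] (Sum.elim x S.init)

/-- The system halts in the state after `t` iterations. -/
def HaltsAt (x : X → ℝ) (t : ℕ) : Prop := 0 < S.haltValue (S.state x t)

open Classical in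
/-- The partial function computed by the system. -/
def eval (x : X → ℝ) : Part (Z → ℝ) :=
  Part.assert (∃ t, S.HaltsAt x t) fun h => Part.some (S.result (S.state x (Nat.find h)))

variable {S}

theorem state_succ (x : X → ℝ) (t : ℕ) : S.state x (t + 1) = S.next (S.state x t) :=
  Function.iterate_succ_apply' ..

open Classical in
theorem mem_eval_iff {x : X → ℝ} {y : Z → ℝ} :
    y ∈ S.eval x ↔
      ∃ t, S.HaltsAt x t ∧ (∀ j < t, ¬ S.HaltsAt x j) ∧ y = S.result (S.state x t) := by
  simp only [eval, ← Part.mem_some_iff]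
  exact mem_assert_find_iff (p := S.HaltsAt x) (g := fun t => Part.some (S.result (S.state x t)))

variable (S)

/-- The index set of the functions a circuit has to compute in one iteration of the system. -/
abbrev Readout (X Y Z : Type) : Type := (X ⊕ Y) ⊕ Z ⊕ Unit

/-- The functions a circuit has to compute in one iteration of the system. -/
def readout : Readout X Y Z → (X ⊕ Y → ℝ) → ℝ :=
  Sum.elim (fun c s => S.next s c) (Sum.elim (fun c s => S.result s c) fun _ s => S.haltValue s)

section RecCircuit

variable (S : RealSystem X Y X) {n ℓ : ℕ} (e : X ≃ Fin n) (e' : Y ≃ Fin ℓ)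
  {C : ExtCircuit n ℓ n} (gate : Readout X Y X → C.Gate) (hgate : ∀ o j, gate o ≠ C.outGate j)

/-- The recurrent circuit for the system with underlying circuit `C`, whose gates `gate` are to
compute the functions `S.readout`. -/
abbrev recCircuit : RecCircuit n n where
  numAux := ℓ
  circ := C
  init := S.init ∘ e'.symm
  recIn j := gate (.inl (.inl (e.symm j)))
  recAux j := gate (.inl (.inr (e'.symm j)))
  recIn_ne _ _ := hgate _ _
  recAux_ne _ _ := hgate _ _
  numHalt := 1
  haltGate := ⟨fun _ => gate (.inr (.inr ())), fun _ _ _ => Subsingleton.elim _ _⟩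
  halt _ v := decide (0 < v 0)

variable {S} {e e' gate hgate}
  (hvalue : ∀ x a o, C.value x a (gate o) = S.readout o (Sum.elim x a ∘ Sum.map e e'))

include hvalue

theorem recCircuit_memory (x : X → ℝ) (t : ℕ) :
    Sum.elim ((S.recCircuit e e' gate hgate).memory (x ∘ e.symm) t).1
      ((S.recCircuit e e' gate hgate).memory (x ∘ e.symm) t).2 ∘ Sum.map e e' = S.state x t := by
  induction t with
  | zero => funext c; obtain c | c := c <;> simp [RecCircuit.memory, recCircuit, state]
  | succ t ih =>
    rw [state_succ, ← ih]
    funext c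
    obtain c | c := c <;> simp [RecCircuit.memory, recCircuit, hvalue, readout]

theorem recCircuit_haltsAt_iff (x : X → ℝ) (t : ℕ) :
    (S.recCircuit e e' gate hgate).HaltsAt (x ∘ e.symm) t ↔ S.HaltsAt x t := by
  rw [HaltsAt, ← recCircuit_memory (hgate := hgate) hvalue]
  exact decide_eq_true_iff.trans (iff_of_eq (congrArg _ (hvalue ..)))

theorem recCircuit_eval
    (heval : ∀ x a j, C.eval x a j = C.value x a (gate (.inr (.inl (e.symm j))))) (x : X → ℝ) :
    (S.recCircuit e e' gate hgate).eval (x ∘ e.symm) = (S.eval x).map (· ∘ e.symm) := by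
  have hresult : ∀ t, C.eval ((S.recCircuit e e' gate hgate).memory (x ∘ e.symm) t).1
      ((S.recCircuit e e' gate hgate).memory (x ∘ e.symm) t).2 =
        S.result (S.state x t) ∘ e.symm := by
    intro t
    funext j
    rw [heval, hvalue, recCircuit_memory hvalue]
    rfl
  ext y
  rw [RecCircuit.mem_eval_iff, Part.mem_map_iff]
  simp only [recCircuit_haltsAt_iff hvalue, mem_eval_iff]
  constructor
  · rintro ⟨t, ht, hmin, rfl⟩
    exact ⟨_, ⟨t, ht, hmin, rfl⟩, (hresult t).symm⟩
  · rintro ⟨_, ⟨t, ht, hmin, rfl⟩, rfl⟩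
    exact ⟨t, ht, hmin, (hresult t).symm⟩

end RecCircuit

end RealSystem

/-- The systems `S p` have polynomially many coordinates and run by a circuit of the class `F`, with
respect to the weight `w p`. -/
structure FeasibleSystem (F : CircuitClass) {P : Type} (w : P → ℕ) {X Y Z : P → Type}
    [∀ p, Fintype (X p)] [∀ p, Fintype (Y p)] (S : ∀ p, RealSystem (X p) (Y p) (Z p)) : Prop where
  card : PolyBdd w fun p => Fintype.card (X p)
  card_aux : PolyBdd w fun p => Fintype.card (Y p)
  next : Feasible F (fun q : Σ p, X p ⊕ Y p => w q.1) fun q s => (S q.1).next s q.2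
  result : Feasible F (fun q : Σ p, Z p => w q.1) fun q s => (S q.1).result s q.2
  haltValue : Feasible F w fun p => (S p).haltValue

/-- The circuit `D 2` decides whether the value of a single halting gate is positive, which is how
the recurrent circuits of dynamical systems halt. -/
def DecidesPositive (D : ∀ k, Circuit k 1) : Prop :=
  ComputesHalt (D (1 + 1)) fun _ (v : Fin 1 → ℝ) => decide (0 < v 0)

theorem exists_decidesPositive {E : CircuitClass} (hE : signFn ∈ E.gates) :
    ∃ D : ∀ k, Circuit k 1, E.IsFamily D ∧ DecidesPositive D := by
  have hfeas : Feasible E (fun k : ℕ => k)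
      fun k (x : Fin k → ℝ) => signFn (if h : 1 < k then x ⟨1, h⟩ else 0) := by
    refine .func (fun _ => hE) ?_
    refine .of_depth_le_const (s := fun _ => 2) (d := 1) (.const 2) fun k => ?_
    by_cases h : 1 < k
    · simpa only [h, dif_pos] using .var _
    · simpa only [h, dif_neg, not_false_eq_true] using
        (NetComputable.const 0).mono one_le_two le_rfl
  obtain ⟨D, hD, heval⟩ := exists_isFamily_of_feasible hfeas
  refine ⟨D, hD, fun i v => ?_⟩
  rw [heval]
  simp only [signFn, decide_eq_true_eq]
  rfl

/-- The recurrent circuit `R` can be the member for inputs of length `n` of a family that witnesses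
membership in a class `rec[𝔉halt]-F`: its size and depth obey bounds given by `a`, `k` and `b`, and
its halting function is computed by the member of `D` for its number of halting gates. -/
structure RecCircuit.Admissible (F : CircuitClass) (D : ∀ k, Circuit k 1) (a k b : ℕ) {n : ℕ}
    (R : RecCircuit n n) : Prop where
  gatesIn : R.circ.GatesIn F.gates
  size_le : R.circ.size ≤ a * (n + 1) ^ k
  depth_le : R.circ.depth ≤ b * binLen n ^ F.exponent
  computesHalt : ComputesHalt (D (R.numHalt + 1)) R.halt

theorem RecCircuit.Admissible.mono {F : CircuitClass} {D : ∀ k, Circuit k 1} {a a' k k' b b' n : ℕ}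
    {R : RecCircuit n n} (h : R.Admissible F D a k b) (ha : a ≤ a') (hk : k ≤ k') (hb : b ≤ b') :
    R.Admissible F D a' k' b' where
  __ := h
  size_le := h.size_le.trans (mul_succ_pow_mono ha hk n)
  depth_le := h.depth_le.trans (Nat.mul_le_mul_right _ hb)

/-- The system that keeps its state and never halts. -/
def RealSystem.idle (n : ℕ) : RealSystem (Fin n) (Fin 0) (Fin n) where
  init := Fin.elim0
  next := id
  result s c := s (.inl c)
  haltValue _ := 0

namespace FeasibleSystem

variable {E F : CircuitClass} {P : Type} {len : P → ℕ} {X Y : P → Type} [∀ p, Fintype (X p)]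
  [∀ p, Fintype (Y p)] {S : ∀ p, RealSystem (X p) (Y p) (X p)}

theorem readout (h : FeasibleSystem F len S) :
    Feasible F (fun q : Σ p, RealSystem.Readout (X p) (Y p) (X p) => len q.1)
      fun q => (S q.1).readout q.2 :=
  have hhalt : Feasible F (fun q : Σ _ : P, Unit => len q.1) fun q => (S q.1).haltValue :=
    h.haltValue.reindex fun q : Σ _ : P, Unit => q.1
  .sigma_sum (I := fun p => X p ⊕ Y p) (J := fun p => X p ⊕ Y p) (K := fun p => X p ⊕ Unit)
    (f := fun q => (S q.1).readout q.2) h.next <|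
  .sigma_sum (I := fun p => X p ⊕ Y p) (J := X) (K := fun _ => Unit)
    (f := fun q => (S q.1).readout (.inr q.2)) h.result hhalt

theorem exists_recCircuit (h : FeasibleSystem F len S) (e : ∀ p, X p ≃ Fin (len p))
    {D : ∀ k, Circuit k 1} (hD : DecidesPositive D) :
    ∃ a k b, ∀ p, ∃ R : RecCircuit (len p) (len p), R.Admissible F D a k b ∧
      ∀ x, R.eval (x ∘ (e p).symm) = ((S p).eval x).map (· ∘ (e p).symm) := by
  obtain ⟨a, k, b, hread⟩ := h.readout
  have hsize : PolyBdd len fun p => len p + Fintype.card (Y p) + len p +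
      2 * (Fintype.card (RealSystem.Readout (X p) (Y p) (X p)) * (a * (len p + 1) ^ k)) := by
    have hcard : PolyBdd len fun p => Fintype.card (RealSystem.Readout (X p) (Y p) (X p)) := by
      simpa only [RealSystem.Readout, Fintype.card_sum, Fintype.card_unit] using
        (h.card.add h.card_aux).add (h.card.add (.const 1))
    exact ((PolyBdd.self.add h.card_aux).add .self).add
      ((PolyBdd.const 2).mul (hcard.mul ⟨a, k, fun _ => le_rfl⟩))
  obtain ⟨a', k', hsize⟩ := hsize
  refine ⟨a', k', 2 * b + 3, fun p => ?_⟩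
  let e' := Fintype.equivFin (Y p)
  have hread' : ∀ o, NetComputable F.gates (fun y => (S p).readout o (y ∘ Sum.map (e p) e'))
      (a * (len p + 1) ^ k) (b * binLen (len p) ^ F.exponent) := fun o =>
    (hread ⟨p, o⟩).rename (Sum.map (e p) e')
  obtain ⟨C, gate, hgate, hvalue, heval, hgates, hCsize, hCdepth⟩ :=
    exists_circuit hread' fun j => .inr (.inl ((e p).symm j))
  have hpos : 1 ≤ binLen (len p) ^ F.exponent := Nat.pow_pos (binLen_pos _)
  refine ⟨(S p).recCircuit (e p) e' gate hgate,
    ⟨hgates, hCsize.trans (hsize p), hCdepth.trans (by linarith), hD⟩, ?_⟩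
  exact RealSystem.recCircuit_eval hvalue fun x a j =>
    (heval x a j).trans (hvalue x a _).symm

theorem idle (F : CircuitClass) : FeasibleSystem F (fun n : ℕ => n) RealSystem.idle where
  card := by simpa using PolyBdd.self
  card_aux := by simpa using PolyBdd.const 0
  next := .var (I := fun q : Σ n : ℕ, Fin n ⊕ Fin 0 => Fin q.1 ⊕ Fin 0) fun q => q.2
  result := .var (I := fun q : Σ n : ℕ, Fin n => Fin q.1 ⊕ Fin 0) fun q => Sum.inl q.2
  haltValue := .const fun _ => 0

theorem exists_mem_recClass (h : FeasibleSystem F len S) (hE : signFn ∈ E.gates)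
    (hlen : Function.Injective len) (e : ∀ p, X p ≃ Fin (len p)) :
    ∃ f ∈ recClass E F, ∀ p (x : X p → ℝ),
      f (List.ofFn (x ∘ (e p).symm)) =
        ((S p).eval x).map fun y => List.ofFn (y ∘ (e p).symm) := by
  obtain ⟨D, hDfam, hD⟩ := exists_decidesPositive hE
  obtain ⟨a, k, b, hR⟩ := h.exists_recCircuit e hD
  obtain ⟨a', k', b', hidle⟩ := (idle F).exists_recCircuit (fun n => Equiv.refl (Fin n)) hD
  have hall : ∀ n, ∃ R : RecCircuit n n, R.Admissible F D (a + a') (k + k') (b + b') ∧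
      ∀ p (x : X p → ℝ) y, List.ofFn y = List.ofFn (x ∘ (e p).symm) →
        (R.eval y).map List.ofFn = ((S p).eval x).map fun y => List.ofFn (y ∘ (e p).symm) := by
    intro n
    by_cases hn : ∃ p, len p = n
    · obtain ⟨p, rfl⟩ := hn
      obtain ⟨R, hadm, heval⟩ := hR p
      refine ⟨R, hadm.mono (Nat.le_add_right ..) (Nat.le_add_right ..) (Nat.le_add_right ..),
        fun q x y hy => ?_⟩
      obtain rfl : q = p := hlen (by simpa using (congrArg List.length hy).symm)
      rw [List.ofFn_injective hy, heval, Part.map_map]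
      rfl
    · obtain ⟨R, hadm, -⟩ := hidle n
      exact ⟨R, hadm.mono (Nat.le_add_left ..) (Nat.le_add_left ..) (Nat.le_add_left ..),
        fun p x y hy => absurd ⟨p, by simpa using (congrArg List.length hy).symm⟩ hn⟩
  choose R hadm heval using hall
  have hfam : F.IsFamily fun n => (R n).circ :=
    isFamily_iff.2 ⟨fun n => (hadm n).gatesIn, ⟨_, _, fun n => (hadm n).size_le⟩, _,
      fun n => (hadm n).depth_le⟩
  exact ⟨_, ⟨⟨id, R⟩, hfam, ⟨D, hDfam, fun n => (hadm n).computesHalt⟩, rfl⟩,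
    fun p x => heval _ p x _ (List.ofFn_get _)⟩

end FeasibleSystem

namespace RealSystem

variable {X Y Z : Type} (S : RealSystem X Y Z)

/-- The system `S`, except that it remains in the first state in which it halts. -/
def freeze : RealSystem X Y Z where
  __ := S
  next s c := select (signFn (S.haltValue s)) (S.next s c) (s c)

variable {S} {x : X → ℝ} {k : ℕ}

theorem freeze_next_of_pos {s : X ⊕ Y → ℝ} (hs : 0 < S.haltValue s) : S.freeze.next s = s := by
  funext c
  simp only [freeze, signFn, if_pos hs, select_one]

theorem freeze_next_of_not_pos {s : X ⊕ Y → ℝ} (hs : ¬ 0 < S.haltValue s) :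
    S.freeze.next s = S.next s := by
  funext c
  simp only [freeze, signFn, if_neg hs, select_zero]

theorem freeze_state_of_not_haltsAt (h : ∀ j < k, ¬ S.HaltsAt x j) :
    S.freeze.state x k = S.state x k := by
  induction k with
  | zero => rfl
  | succ k ih =>
    rw [state_succ, state_succ, ih fun j hj => h j (hj.trans k.lt_succ_self)]
    exact freeze_next_of_not_pos (h k k.lt_succ_self)

theorem exists_freeze_state_eq (h : ∃ j ≤ k, S.HaltsAt x j) :
    ∃ t, S.HaltsAt x t ∧ (∀ j < t, ¬ S.HaltsAt x j) ∧ S.freeze.state x k = S.state x t := by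
  classical
  obtain ⟨j, hjk, hj⟩ := h
  have hhalts : ∃ t, S.HaltsAt x t := ⟨j, hj⟩
  have hmin : ∀ i < Nat.find hhalts, ¬ S.HaltsAt x i := fun i => Nat.find_min hhalts
  refine ⟨Nat.find hhalts, Nat.find_spec hhalts, hmin, ?_⟩
  obtain ⟨i, rfl⟩ := Nat.exists_eq_add_of_le' ((Nat.find_min' hhalts hj).trans hjk)
  rw [← freeze_state_of_not_haltsAt hmin, state, Function.iterate_add_apply]
  refine Function.iterate_fixed (freeze_next_of_pos ?_) i
  rw [← state, freeze_state_of_not_haltsAt hmin]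
  exact Nat.find_spec hhalts

theorem freeze_haltsAt_iff : S.freeze.HaltsAt x k ↔ ∃ j ≤ k, S.HaltsAt x j := by
  by_cases h : ∃ j ≤ k, S.HaltsAt x j
  · obtain ⟨t, ht, -, hstate⟩ := exists_freeze_state_eq h
    exact iff_of_true (by rwa [HaltsAt, hstate]) h
  · refine iff_of_false (fun hk => h ⟨k, le_rfl, ?_⟩) h
    push Not at h
    rwa [HaltsAt, freeze_state_of_not_haltsAt fun j hj => h j hj.le] at hk

theorem result_freeze_state_mem_eval (h : S.freeze.HaltsAt x k) :
    S.result (S.freeze.state x k) ∈ S.eval x := by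
  obtain ⟨t, ht, hmin, hstate⟩ := exists_freeze_state_eq (freeze_haltsAt_iff.1 h)
  exact mem_eval_iff.2 ⟨t, ht, hmin, by rw [hstate]⟩

end RealSystem

namespace RecCircuit

variable {n m : ℕ} (R : RecCircuit n m)

/-- The value of a gate of the recurrent circuit `R`, if the memory gates have the values given by
the state `s` of the system `R.toSystem`. -/
def gateValue (s : Fin n ⊕ Unit ⊕ Fin R.numAux → ℝ) (g : R.circ.Gate) : ℝ :=
  R.circ.value (fun j => s (.inl j)) (fun j => s (.inr (.inr j))) g

/-- The recurrent circuit `R`, with halting function given by the circuit `D`, as a dynamical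
system. It has one more auxiliary coordinate than `R`, for the iteration number, and its result is
the value of the first output gate, or `0` if there is no output gate. -/
def toSystem (D : Circuit (R.numHalt + 1) 1) :
    RealSystem (Fin n) (Unit ⊕ Fin R.numAux) Unit where
  init := Sum.elim (fun _ => 1) R.init
  next s := Sum.elim (fun j => R.gateValue s (R.recIn j))
    (Sum.elim (fun _ => s (.inr (.inl ())) + 1) fun j => R.gateValue s (R.recAux j))
  result s _ := (List.ofFn fun j => R.gateValue s (R.circ.outGate j)).headD 0
  haltValue s :=
    D.eval (Fin.cons (s (.inr (.inl ()))) fun j => R.gateValue s (R.haltGate j)) Fin.elim0 0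

variable {R} {D : Circuit (R.numHalt + 1) 1}

theorem toSystem_state (x : Fin n → ℝ) (k : ℕ) :
    (R.toSystem D).state x k =
      Sum.elim (R.memory x k).1 (Sum.elim (fun _ => (k : ℝ) + 1) (R.memory x k).2) := by
  induction k with
  | zero => simp [RealSystem.state, toSystem, memory]
  | succ k ih => rw [RealSystem.state_succ, ih]; simp [toSystem, gateValue, memory]

theorem toSystem_haltsAt_iff (hD : ComputesHalt D R.halt) (x : Fin n → ℝ) (k : ℕ) :
    (R.toSystem D).HaltsAt x k ↔ R.HaltsAt x k := by
  have hvalue := hD k.succPNat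
    fun j => R.circ.value (R.memory x k).1 (R.memory x k).2 (R.haltGate j)
  rw [Nat.succPNat_coe, Nat.cast_succ] at hvalue
  rw [RealSystem.HaltsAt, toSystem_state]
  refine (iff_of_eq (congrArg (0 < ·) hvalue)).trans ?_
  rw [HaltsAt]
  split_ifs with h <;> simp [h]

theorem toSystem_eval (hD : ComputesHalt D R.halt) (x : Fin n → ℝ) :
    (R.toSystem D).eval x = (R.eval x).map fun y _ => (List.ofFn y).headD 0 := by
  ext y
  rw [RealSystem.mem_eval_iff, Part.mem_map_iff]
  simp only [toSystem_haltsAt_iff hD, toSystem_state, mem_eval_iff]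
  constructor
  · rintro ⟨t, ht, hmin, rfl⟩
    exact ⟨_, ⟨t, ht, hmin, rfl⟩, rfl⟩
  · rintro ⟨_, ⟨t, ht, hmin, rfl⟩, rfl⟩
    exact ⟨t, ht, hmin, rfl⟩

theorem numAux_le_size : R.numAux ≤ R.circ.size := by
  simpa [ExtCircuit.size] using Fintype.card_le_of_injective _ R.circ.auxGate_injective

theorem numHalt_le_size : R.numHalt ≤ R.circ.size := by
  simpa [ExtCircuit.size] using Fintype.card_le_of_injective _ R.haltGate.injective

end RecCircuit

theorem headD_ofFn {α : Type*} {n : ℕ} (g : Fin n → α) (a : α) :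
    (List.ofFn g).headD a = if h : 0 < n then g ⟨0, h⟩ else a := by
  cases n <;> simp

theorem RecFamily.eval_ofFn (R : RecFamily) {n : ℕ} (x : Fin n → ℝ) :
    R.eval (List.ofFn x) = ((R.circuit n).eval x).map List.ofFn := by
  have eval_of_length : ∀ (l : List ℝ) (h : l.length = n),
      (∀ j : Fin n, l.get (j.cast h.symm) = x j) →
        R.eval l = ((R.circuit n).eval x).map List.ofFn := by
    rintro l rfl h
    rw [RecFamily.eval, show l.get = x from funext h]
  exact eval_of_length _ List.length_ofFn fun j => by simp

namespace FeasibleSystem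

variable {F : CircuitClass}

section Family

variable {R : RecFamily} {D : ∀ k, Circuit k 1} (hR : F.IsFamily fun n => (R.circuit n).circ)

include hR

theorem polyBdd_circ_size : PolyBdd (fun n : ℕ => n) fun n => (R.circuit n).circ.size :=
  (isFamily_iff.1 hR).2.1

theorem feasible_gateValue :
    Feasible F (fun q : Σ n, (R.circuit n).circ.Gate => q.1)
      (I := fun q => Fin q.1 ⊕ Unit ⊕ Fin (R.circuit q.1).numAux)
      fun q s => (R.circuit q.1).gateValue s q.2 :=
  (feasible_value hR).rename fun _ => Sum.elim Sum.inl (Sum.inr ∘ Sum.inr)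

theorem feasible_toSystem_next :
    Feasible F (fun q : Σ n, Fin n ⊕ Unit ⊕ Fin (R.circuit n).numAux => q.1)
      fun q s => ((R.circuit q.1).toSystem (D _)).next s q.2 := by
  let I (n : ℕ) : Type := Fin n ⊕ Unit ⊕ Fin (R.circuit n).numAux
  refine .sigma_sum (w := id) (I := I) ?_ (.sigma_sum (w := id) (I := I) ?_ ?_)
  · exact (feasible_gateValue hR).reindex fun q : Σ n, Fin n => ⟨q.1, (R.circuit q.1).recIn q.2⟩
  · exact (Feasible.var _).add (.const _)
  · exact (feasible_gateValue hR).reindex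
      fun q : Σ n, Fin (R.circuit n).numAux => ⟨q.1, (R.circuit q.1).recAux q.2⟩

theorem feasible_toSystem_result :
    Feasible F (fun q : Σ _ : ℕ, Unit => q.1)
      fun q s => ((R.circuit q.1).toSystem (D _)).result s q.2 := by
  refine .of_cover (P₁ := {n // 0 < R.numOut n}) (P₂ := {n // R.numOut n = 0})
    (fun n => ⟨n, ()⟩) (fun n => ⟨n, ()⟩) ?_ ?_ ?_
  · convert (feasible_gateValue hR).reindex
      fun n : {n // 0 < R.numOut n} => ⟨n, (R.circuit n).circ.outGate ⟨0, n.2⟩⟩ using 3 with n s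
    exact (headD_ofFn ..).trans (dif_pos n.2)
  · convert Feasible.const fun _ => 0 using 3 with n s
    exact (headD_ofFn ..).trans (dif_neg n.2.not_gt)
  · rintro ⟨n, -⟩
    exact (Nat.eq_zero_or_pos (R.numOut n)).symm.imp (fun h => ⟨⟨n, h⟩, rfl⟩) fun h => ⟨⟨n, h⟩, rfl⟩

theorem feasible_toSystem_haltValue (hD : F.IsFamily D) :
    Feasible F (fun n => n) fun n => ((R.circuit n).toSystem (D _)).haltValue := by
  have hnumHalt : PolyBdd (fun n => n) fun n => (R.circuit n).numHalt + 1 :=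
    ((polyBdd_circ_size hR).mono fun _ => RecCircuit.numHalt_le_size).add (.const 1)
  refine (((feasible_eval hD).reindex fun n => (R.circuit n).numHalt + 1).reweight hnumHalt).subst
    ?_ (by simpa using hnumHalt)
  let I (n : ℕ) : Type := Fin n ⊕ Unit ⊕ Fin (R.circuit n).numAux
  refine .sigma_fin (w := id) (I := I) ?_ ?_
  · exact .var (I := I) fun _ => .inr (.inl ())
  · exact (feasible_gateValue hR).reindex
      fun q : Σ n, Fin (R.circuit n).numHalt => ⟨q.1, (R.circuit q.1).haltGate q.2⟩

theorem toSystem (hD : F.IsFamily D) :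
    FeasibleSystem F (fun n => n) fun n => (R.circuit n).toSystem (D _) where
  card := by simpa using PolyBdd.self
  card_aux := by
    simpa using (PolyBdd.const 1).add
      ((polyBdd_circ_size hR).mono fun _ => RecCircuit.numAux_le_size)
  next := feasible_toSystem_next hR
  result := feasible_toSystem_result hR
  haltValue := feasible_toSystem_haltValue hR hD

end Family

theorem exists_eval_eq {f : List ℝ →. ℝ} (hf : (fun x => (f x).map fun y => [y]) ∈ recClass F F) :
    ∃ (ℓ : ℕ → ℕ) (S : ∀ n, RealSystem (Fin n) (Unit ⊕ Fin (ℓ n)) Unit),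
      FeasibleSystem F (fun n => n) S ∧
        ∀ n x, f (List.ofFn x) = ((S n).eval x).map fun y => y () := by
  obtain ⟨R, hR, ⟨D, hD, hhalt⟩, heval⟩ := hf
  refine ⟨_, _, toSystem hR hD, fun n x => ?_⟩
  have hlift := congrArg (Part.map fun l : List ℝ => l.headD 0) (congrFun heval (List.ofFn x))
  rw [R.eval_ofFn, Part.map_map, Part.map_map] at hlift
  rw [RecCircuit.toSystem_eval (hhalt n), Part.map_map]
  exact (hlift.trans (Part.map_id' (fun _ => rfl) _)).symm

section Operations

variable {P : Type} {w : P → ℕ} {X Y Z : P → Type} [∀ p, Fintype (X p)] [∀ p, Fintype (Y p)]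
  {S : ∀ p, RealSystem (X p) (Y p) (Z p)}

theorem freeze (hF : signFn ∈ F.gates) (h : FeasibleSystem F w S) :
    FeasibleSystem F w fun p => (S p).freeze where
  __ := h
  next := ((h.haltValue.func fun _ => hF).reindex _).select h.next (.var _)

theorem reindex {P' : Type} (q : P' → P) (h : FeasibleSystem F w S) :
    FeasibleSystem F (fun p => w (q p)) fun p => S (q p) where
  card := h.card.reindex q
  card_aux := h.card_aux.reindex q
  next := h.next.reindex fun r : Σ p, X (q p) ⊕ Y (q p) => ⟨q r.1, r.2⟩
  result := h.result.reindex fun r : Σ p, Z (q p) => ⟨q r.1, r.2⟩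
  haltValue := h.haltValue.reindex q

theorem reweight {w' : P → ℕ} (hw : PolyBdd w' w) (h : FeasibleSystem F w S) :
    FeasibleSystem F w' S where
  card := h.card.trans hw
  card_aux := h.card_aux.trans hw
  next := h.next.reweight (hw.reindex _)
  result := h.result.reweight (hw.reindex _)
  haltValue := h.haltValue.reweight hw

end Operations

theorem sigma {ι : Type} [Finite ι] {P : ι → Type} {w : ∀ i, P i → ℕ}
    {X Y Z : ∀ i, P i → Type} [∀ i p, Fintype (X i p)] [∀ i p, Fintype (Y i p)]
    {S : ∀ i p, RealSystem (X i p) (Y i p) (Z i p)} (h : ∀ i, FeasibleSystem F (w i) (S i)) :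
    FeasibleSystem F (fun q : Σ i, P i => w q.1 q.2) fun q => S q.1 q.2 where
  card := .sigma fun i => (h i).card
  card_aux := .sigma fun i => (h i).card_aux
  next := (Feasible.sigma fun i => (h i).next).reindex
    fun r : Σ q : Σ i, P i, X q.1 q.2 ⊕ Y q.1 q.2 => ⟨r.1.1, r.1.2, r.2⟩
  result := (Feasible.sigma fun i => (h i).result).reindex
    fun r : Σ q : Σ i, P i, Z q.1 q.2 => ⟨r.1.1, r.1.2, r.2⟩
  haltValue := .sigma fun i => (h i).haltValue

end FeasibleSystem

/-! ### Neighbours and encodings of labelled graphs -/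

/-- The indicator of `z = j` for integers `z`, expressed by the sign function. -/
def eqInd (z : ℝ) (j : ℕ) : ℝ := signFn (z - (j - 1 / 2)) * signFn (j + 1 / 2 - z)

theorem eqInd_natCast (k j : ℕ) : eqInd k j = if k = j then 1 else 0 := by
  unfold eqInd signFn
  rcases lt_trichotomy k j with hlt | rfl | hgt
  · have hle : (k : ℝ) + 1 ≤ j := by exact_mod_cast hlt
    rw [if_neg (by linarith), if_neg hlt.ne, zero_mul]
  · rw [if_pos (by linarith), if_pos (by linarith), if_pos rfl, one_mul]
  · have hle : (j : ℝ) + 1 ≤ k := by exact_mod_cast hgt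
    rw [if_neg (c := (0 : ℝ) < j + 1 / 2 - k) (by linarith), if_neg hgt.ne', mul_zero]

theorem Feasible.eqInd {F : CircuitClass} {P : Type} {w : P → ℕ} {I : P → Type}
    {f : ∀ p, (I p → ℝ) → ℝ} (hF : signFn ∈ F.gates) (hf : Feasible F w f) (j : P → ℕ) :
    Feasible F w fun p x => eqInd (f p x) (j p) :=
  ((hf.sub (.const _)).func fun _ => hF).mul (((Feasible.const _).sub hf).func fun _ => hF)

theorem length_filter_finRange {n : ℕ} (p : Fin n → Prop) [DecidablePred p] :
    ((List.finRange n).filter fun u => p u).length = ∑ u, if p u then 1 else 0 := by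
  rw [← Finset.card_filter]
  rfl

theorem getD_concat (l : List ℝ) (a : ℝ) (j : ℕ) :
    (l ++ [a]).getD j 0 = l.getD j 0 + if l.length = j then a else 0 := by
  rcases lt_trichotomy j l.length with hlt | rfl | hgt
  · rw [List.getD_append _ _ _ _ hlt, if_neg hlt.ne', add_zero]
  · simp
  · rw [List.getD_eq_default _ _ (by simpa using hgt), List.getD_eq_default _ _ hgt.le,
      if_neg hgt.ne, add_zero]

theorem getD_map_filter_finRange {n : ℕ} (p : Fin n → Prop) [DecidablePred p] (g : Fin n → ℝ)
    (j : ℕ) :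
    (((List.finRange n).filter fun u => p u).map g).getD j 0 =
      ∑ u, if p u ∧ (∑ u', if u' < u ∧ p u' then 1 else 0) = j then g u else 0 := by
  induction n with
  | zero => simp
  | succ n ih =>
    set l := (List.finRange n).filter fun u => p u.castSucc
    have hsplit : ((List.finRange (n + 1)).filter fun u => p u).map g =
        l.map (fun u => g u.castSucc) ++ if p (Fin.last n) then [g (Fin.last n)] else [] := by
      rw [List.finRange_succ_last, List.filter_append, List.map_append, List.filter_map,
        List.map_map]
      split_ifs with hlast <;> simp [hlast, l, Function.comp_def]
    have hlen : l.length = ∑ u : Fin n, if p u.castSucc then 1 else 0 := length_filter_finRange _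
    rw [hsplit, Fin.sum_univ_castSucc]
    simp only [Fin.sum_univ_castSucc, Fin.castSucc_lt_castSucc_iff, Fin.castSucc_lt_last, true_and,
      lt_self_iff_false, false_and, if_false, add_zero, (Fin.castSucc_lt_last _).not_gt]
    rw [← ih (fun u => p u.castSucc) fun u => g u.castSucc, ← hlen]
    by_cases hlast : p (Fin.last n)
    · rw [if_pos hlast, getD_concat, List.length_map]
      simp only [hlast, true_and]
      rfl
    · simp only [hlast, if_false, List.append_nil, false_and, add_zero]
      rfl

/-- The coordinates of the encoding of a labelled graph of order `n`: the entries of the adjacency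
matrix and the features. -/
abbrev InCoord (n : ℕ) : Type := (Fin n × Fin n) ⊕ Fin n

/-- The order of the coordinates in the encoding. -/
def inCoordEquiv (n : ℕ) : InCoord n ≃ Fin (n * n + n) :=
  (Equiv.sumCongr finProdFinEquiv (Equiv.refl _)).trans finSumFinEquiv

theorem mul_self_add_self_injective : Function.Injective fun n : ℕ => n * n + n :=
  StrictMono.injective fun _ _ h => Nat.add_lt_add (Nat.mul_self_lt_mul_self h) h

namespace LabelledGraph

variable (G : LabelledGraph)

open Classical in
/-- The entries of the encoding of a labelled graph, indexed by coordinates. -/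
def coordinates : InCoord G.order → ℝ :=
  Sum.elim (fun p => if G.graph.Adj p.1 p.2 then 1 else 0) G.feature

theorem encode_eq_ofFn :
    G.encode = List.ofFn (G.coordinates ∘ (inCoordEquiv G.order).symm) := by
  have coordinates_eq : ∀ (c : InCoord G.order) (j : Fin (G.order * G.order + G.order)),
      (inCoordEquiv G.order c : ℕ) = j →
        G.coordinates c = (G.coordinates ∘ (inCoordEquiv G.order).symm) j := by
    intro c j h
    obtain rfl := Fin.ext h
    simp
  rw [List.ofFn_add, List.ofFn_mul, encode]
  congr 1
  · congr 2
    funext v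
    congr 1
    funext w
    exact coordinates_eq (.inl (v, w)) _ (by simp [inCoordEquiv, mul_comm, add_comm])
  · congr 1
    funext v
    exact coordinates_eq (.inr v) _ (by simp [inCoordEquiv])

/-- The labelled graph with the same underlying graph and with features `h`. -/
abbrev withFeature (h : Fin G.order → ℝ) : LabelledGraph := ⟨G.order, G.graph, h⟩

open Classical in
/-- The degree of a vertex. -/
def degree (w : Fin G.order) : ℕ := ∑ u, if G.graph.Adj w u then 1 else 0

theorem length_neighbourFeatures (h : Fin G.order → ℝ) (w : Fin G.order) :
    (G.neighbourFeatures h w).length = G.degree w := by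
  rw [neighbourFeatures, List.length_map, length_filter_finRange, degree]

theorem degree_lt (w : Fin G.order) : G.degree w < G.order := by
  classical
  rw [degree, ← Finset.card_filter]
  exact (Finset.card_lt_univ_of_notMem (x := w) (by simp)).trans_eq (Fintype.card_fin _)

/-- The arguments of the function of a layer at the vertex `w`. -/
def layerInput (h : Fin G.order → ℝ) (w : Fin G.order) : Fin (G.degree w + 1) → ℝ :=
  Fin.cons (h w) fun j => (G.neighbourFeatures h w).getD j 0

theorem ofFn_layerInput (h : Fin G.order → ℝ) (w : Fin G.order) :
    List.ofFn (G.layerInput h w) = h w :: G.neighbourFeatures h w := by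
  rw [layerInput, List.ofFn_succ]
  simp only [Fin.cons_zero, Fin.cons_succ, List.cons.injEq, true_and]
  refine List.ext_getElem (by simp [length_neighbourFeatures]) fun i _ hi => ?_
  simp [hi]

end LabelledGraph

namespace RecGNN

variable {N : RecGNN} {G : LabelledGraph}

theorem mem_features_succ_iff {i : ℕ} {H H' : Fin G.order → ℝ} (hH : H ∈ N.features G i) :
    H' ∈ N.features G (i + 1) ↔
      ∀ w, ∃ y ∈ (N.layer (i + 1)).1 (H w :: G.neighbourFeatures H w),
        (N.layer (i + 1)).2 y = H' w := by
  rw [features, Part.eq_some_iff.2 hH, Part.bind_some]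
  constructor
  · rintro ⟨hdom, rfl⟩ w
    exact ⟨_, Part.get_mem (hdom w), rfl⟩
  · intro h
    choose y hy hyH using h
    refine ⟨fun w => Part.dom_iff_mem.2 ⟨y w, hy w⟩, funext fun w => ?_⟩
    rw [← hyH, ← Part.get_eq_of_mem (hy w)]

open Classical in
theorem mem_eval_iff {G' : LabelledGraph} :
    G' ∈ N.eval G ↔ ∃ i, N.HaltsAt G i ∧ (∀ j < i, ¬ N.HaltsAt G j) ∧
      ∃ H ∈ N.features G (i + 1), G.withFeature H = G' := by
  simp only [eval, ← Part.mem_map_iff]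
  exact mem_assert_find_iff (p := N.HaltsAt G)
    (g := fun i => (N.features G (i + 1)).map G.withFeature)

end RecGNN

/-! ### The simulation of networks -/

/-- Dynamical systems and functions that stand for the layers, the activation functions and the
halting function of a network: `layer c m` is for the layers whose number has residue `c` modulo the
period `d` and for vertices of degree `m`. The first argument of `halt n` is the layer number. -/
structure Realization (d : ℕ) where
  Aux : ZMod d → ℕ → Type
  [fintypeAux : ∀ c m, Fintype (Aux c m)]
  layer : ∀ c m, RealSystem (Fin (m + 1)) (Aux c m) Unit
  act : ZMod d → ℝ → ℝ
  halt : ∀ n, (Fin (n + 1) → ℝ) → ℝ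

attribute [instance] Realization.fintypeAux

namespace Realization

variable {d : ℕ} (S : Realization d)

/-- The index set of the computations that the simulation on graphs of order `n` performs in
parallel: one for each vertex, residue and degree. Only one per vertex is relevant in each layer. -/
abbrev Task (d n : ℕ) : Type := Fin n × ZMod d × Fin n

variable {n : ℕ}

/-- The system that performs a task. -/
abbrev taskSystem (q : Task d n) : RealSystem (Fin (q.2.2 + 1)) (S.Aux q.2.1 q.2.2) Unit :=
  S.layer q.2.1 q.2.2

/-- The coordinates of the states of the system for a task. -/
abbrev TaskCoord (q : Task d n) : Type := Fin (q.2.2 + 1) ⊕ S.Aux q.2.1 q.2.2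

variable (n) in
/-- The auxiliary coordinates of the simulation: the number of the current layer, a flag for its
first iteration, the indicator of the residue of its number, and the states of all tasks. -/
abbrev AuxCoord : Type := (Unit ⊕ Unit) ⊕ ZMod d ⊕ Σ q : Task d n, S.TaskCoord q

variable (n) in
/-- The coordinates of the states of the simulation. -/
abbrev StateCoord : Type := InCoord n ⊕ S.AuxCoord n

variable (s : S.StateCoord n → ℝ)

/-- The adjacency matrix. -/
def adj (u v : Fin n) : ℝ := s (.inl (.inl (u, v)))

/-- The features before the current layer. -/
def feature (v : Fin n) : ℝ := s (.inl (.inr v))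

/-- The number of the current layer. -/
def layerNumber : ℝ := s (.inr (.inl (.inl ())))

/-- The flag for the first iteration in the current layer. -/
def fresh : ℝ := s (.inr (.inl (.inr ())))

/-- The indicator of the residue of the number of the current layer. -/
def phase (c : ZMod d) : ℝ := s (.inr (.inr (.inl c)))

/-- The state of a task as the previous iteration left it. -/
def stored (q : Task d n) (x : S.TaskCoord q) : ℝ := s (.inr (.inr (.inr ⟨q, x⟩)))

/-- The degree of a vertex. -/
def degree (w : Fin n) : ℝ := ∑ u, S.adj s w u

/-- The indicator of the tasks that are relevant for the graph in the current layer. -/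
def isActive (q : Task d n) : ℝ := S.phase s q.2.1 * eqInd (S.degree s q.1) q.2.2

/-- The number of neighbours of `w` before `u`. -/
def numNeighboursBefore (w u : Fin n) : ℝ := ∑ u', (if u' < u then 1 else 0) * S.adj s w u'

/-- The feature of the `j`th neighbour of `w`. -/
def neighbourFeature (w : Fin n) (j : ℕ) : ℝ :=
  ∑ u, S.feature s u * (S.adj s w u * eqInd (S.numNeighboursBefore s w u) j)

/-- The state in which a task starts in the current layer. -/
def initial (q : Task d n) : S.TaskCoord q → ℝ :=
  Sum.elim (Fin.cons (S.feature s q.1) fun j => S.neighbourFeature s q.1 j) (S.taskSystem q).init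

/-- The current state of a task. -/
def current (q : Task d n) (x : S.TaskCoord q) : ℝ :=
  select (S.fresh s) (S.stored s q x) (S.initial s q x)

/-- The indicator of the tasks that have halted. -/
def hasHalted (q : Task d n) : ℝ := signFn ((S.taskSystem q).haltValue (S.current s q))

/-- The value that a task contributes as a new feature, once it has halted. -/
def output (q : Task d n) : ℝ := S.act q.2.1 ((S.taskSystem q).result (S.current s q) ())

variable [NeZero d]

/-- The indicator of the event that the relevant tasks of all vertices have halted. -/
def allHalted : ℝ := ∏ w, ∑ p : ZMod d × Fin n, S.isActive s (w, p) * S.hasHalted s (w, p)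

/-- The features after the current layer. -/
def newFeature (w : Fin n) : ℝ :=
  ∑ p : ZMod d × Fin n, S.isActive s (w, p) * S.output s (w, p)

variable (n) in
/-- The simulation on graphs of order `n`. An iteration in which all relevant tasks have halted
passes to the next layer. -/
def system : RealSystem (InCoord n) (S.AuxCoord n) (InCoord n) where
  init := Sum.elim (fun _ => 1) (Sum.elim (fun c => if c = 1 then 1 else 0) fun _ => 0)
  next s :=
    Sum.elim
      (Sum.elim (fun p => S.adj s p.1 p.2)
        fun v => select (S.allHalted s) (S.feature s v) (S.newFeature s v))
      (Sum.elim
        (Sum.elim (fun _ => S.layerNumber s + S.allHalted s) fun _ => S.allHalted s)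
        (Sum.elim
          (fun c => select (S.allHalted s) (S.phase s c) (S.phase s (c - 1)))
          fun r => (S.taskSystem r.1).freeze.next (S.current s r.1) r.2))
  result s := Sum.elim (fun p => S.adj s p.1 p.2) (S.newFeature s)
  haltValue s := S.allHalted s * S.halt n (Fin.cons (S.layerNumber s) (S.newFeature s))

end Realization

/-! ### Feasibility of the simulation -/

theorem polyBdd_card_fin {P : Type} {w : P → ℕ} : PolyBdd w fun p => Fintype.card (Fin (w p)) := by
  simpa only [Fintype.card_fin] using PolyBdd.self

namespace Realization

/-- The functions of a realization are computed by circuits of the class `F`. -/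
structure IsFeasible {d : ℕ} (S : Realization d) (F : CircuitClass) : Prop where
  layer : FeasibleSystem F (fun q : Σ _ : ZMod d, ℕ => q.2) fun q => S.layer q.1 q.2
  act : ∀ c, S.act c ∈ F.gates
  halt : Feasible F (fun n => n) S.halt

variable {d : ℕ} {S : Realization d} {F : CircuitClass} {P : Type} {order : P → ℕ}

/-- Feasibility of functions of the states of the simulation on graphs of order `order p`. -/
abbrev FeasibleOn (S : Realization d) (F : CircuitClass) (order : P → ℕ)
    (f : ∀ p, (S.StateCoord (order p) → ℝ) → ℝ) : Prop :=
  Feasible F order (I := fun p => S.StateCoord (order p)) f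

theorem feasible_adj (u v : ∀ p, Fin (order p)) :
    S.FeasibleOn F order fun p s => S.adj s (u p) (v p) :=
  .var _

theorem feasible_feature (v : ∀ p, Fin (order p)) :
    S.FeasibleOn F order fun p s => S.feature s (v p) :=
  .var _

theorem feasible_layerNumber : S.FeasibleOn F order fun _ s => S.layerNumber s := .var _

theorem feasible_phase (c : P → ZMod d) : S.FeasibleOn F order fun p s => S.phase s (c p) := .var _

theorem feasible_degree (w : ∀ p, Fin (order p)) :
    S.FeasibleOn F order fun p s => S.degree s (w p) := by
  let orderOf (q : Σ p, Fin (order p)) : ℕ := order q.1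
  exact .sum (feasible_adj (order := orderOf) (fun q => w q.1) fun q => q.2) polyBdd_card_fin

theorem feasible_numNeighboursBefore (w u : ∀ p, Fin (order p)) :
    S.FeasibleOn F order fun p s => S.numNeighboursBefore s (w p) (u p) := by
  refine .sum (J := fun p => Fin (order p)) ?_ polyBdd_card_fin
  let orderOf (q : Σ p, Fin (order p)) : ℕ := order q.1
  have hadj : S.FeasibleOn F orderOf fun q s => S.adj s (w q.1) q.2 :=
    feasible_adj (order := orderOf) (fun q => w q.1) fun q => q.2
  exact (Feasible.const _).mul hadj

section Sign

variable (hF : signFn ∈ F.gates)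

include hF

theorem feasible_isActive (q : ∀ p, Task d (order p)) :
    S.FeasibleOn F order fun p s => S.isActive s (q p) :=
  (feasible_phase _).mul ((feasible_degree _).eqInd hF _)

theorem feasible_neighbourFeature (w : ∀ p, Fin (order p)) (j : P → ℕ) :
    S.FeasibleOn F order fun p s => S.neighbourFeature s (w p) (j p) := by
  let orderOf (q : Σ p, Fin (order p)) : ℕ := order q.1
  refine .sum (J := fun p => Fin (order p)) (f := fun p u s => S.feature s u *
    (S.adj s (w p) u * eqInd (S.numNeighboursBefore s (w p) u) (j p))) ?_ polyBdd_card_fin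
  have hbefore : S.FeasibleOn F orderOf fun q s => S.numNeighboursBefore s (w q.1) q.2 :=
    feasible_numNeighboursBefore (order := orderOf) (fun q => w q.1) fun q => q.2
  exact (feasible_feature (order := orderOf) fun q => q.2).mul
    ((feasible_adj (order := orderOf) (fun q => w q.1) fun q => q.2).mul
      (hbefore.eqInd hF fun q => j q.1))

theorem feasible_initial (q : ∀ p, Task d (order p)) :
    S.FeasibleOn F (fun r : Σ p, S.TaskCoord (q p) => order r.1)
      fun r s => S.initial s (q r.1) r.2 := by
  let I (p : P) : Type := S.StateCoord (order p)
  refine .sigma_sum (w := order) (I := I) (.sigma_fin (w := order) (I := I) ?_ ?_) (.const _)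
  · exact feasible_feature _
  · exact feasible_neighbourFeature hF (order := fun r : Σ p, Fin (q p).2.2 => order r.1)
      (fun r => (q r.1).1) fun r => r.2

theorem feasible_current (q : ∀ p, Task d (order p)) :
    S.FeasibleOn F (fun r : Σ p, S.TaskCoord (q p) => order r.1)
      fun r s => S.current s (q r.1) r.2 :=
  .select (.var _) (.var _) (feasible_initial hF q)

end Sign

namespace IsFeasible

variable (h : S.IsFeasible F)

include h

theorem taskSystem (q : ∀ p, Task d (order p)) :
    FeasibleSystem F order fun p => S.taskSystem (q p) :=
  (h.layer.reindex fun p => ⟨(q p).2.1, (q p).2.2⟩).reweight (.mono .self fun p => (q p).2.2.2.le)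

theorem polyBdd_card_taskCoord (q : ∀ p, Task d (order p)) :
    PolyBdd order fun p => Fintype.card (S.TaskCoord (q p)) := by
  simpa only [Fintype.card_sum] using (h.taskSystem q).card.add (h.taskSystem q).card_aux

variable (hF : signFn ∈ F.gates)

include hF

theorem hasHalted (q : ∀ p, Task d (order p)) :
    S.FeasibleOn F order fun p s => S.hasHalted s (q p) :=
  (((h.taskSystem q).haltValue).subst (feasible_current hF q)
    (h.polyBdd_card_taskCoord q)).func fun _ => hF

theorem output (q : ∀ p, Task d (order p)) :
    S.FeasibleOn F order fun p s => S.output s (q p) :=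
  .func (fun _ => h.act _) <|
    ((h.taskSystem q).result.reindex fun p : P => ⟨p, ()⟩).subst (feasible_current hF q)
      (h.polyBdd_card_taskCoord q)

theorem freeze_next (q : ∀ p, Task d (order p)) (x : ∀ p, S.TaskCoord (q p)) :
    S.FeasibleOn F order fun p s => (S.taskSystem (q p)).freeze.next (S.current s (q p)) (x p) :=
  (((h.taskSystem q).freeze hF).next.reindex fun p : P => ⟨p, x p⟩).subst
    (feasible_current hF q) (h.polyBdd_card_taskCoord q)

variable [NeZero d]

omit h hF in
theorem polyBdd_card_zmod_prod_fin :
    PolyBdd order fun p => Fintype.card (ZMod d × Fin (order p)) := by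
  simpa only [Fintype.card_prod, Fintype.card_fin, ZMod.card] using (PolyBdd.const d).mul .self

omit hF in
theorem polyBdd_card_auxCoord : PolyBdd order fun p => Fintype.card (S.AuxCoord (order p)) := by
  have htasks : PolyBdd order fun p => Fintype.card (Σ q : Task d (order p), S.TaskCoord q) := by
    simp only [Fintype.card_sigma]
    refine .sum (J := fun p => Task d (order p)) (b := fun p q => Fintype.card (S.TaskCoord q))
      ?_ (h.polyBdd_card_taskCoord (order := fun q : Σ p, Task d (order p) => order q.1)
        fun q => q.2)
    simpa only [Fintype.card_prod] using
      polyBdd_card_fin.mul (polyBdd_card_zmod_prod_fin (order := order) (d := d))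
  refine ((PolyBdd.const 2).add ((PolyBdd.const d).add htasks)).mono fun p => ?_
  simp only [Fintype.card_sum, Fintype.card_unit, ZMod.card, le_refl, Nat.reduceAdd]

theorem allHalted : S.FeasibleOn F order fun _ s => S.allHalted s := by
  refine .prod (J := fun p => Fin (order p)) ?_ polyBdd_card_fin
  refine .sum (J := fun r : Σ p, Fin (order p) => ZMod d × Fin (order r.1)) ?_
    polyBdd_card_zmod_prod_fin
  let task (r : Σ r : Σ p, Fin (order p), ZMod d × Fin (order r.1)) : Task d (order r.1.1) :=
    (r.1.2, r.2)
  exact (feasible_isActive hF task).mul (h.hasHalted hF task)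

theorem newFeature (v : ∀ p, Fin (order p)) :
    S.FeasibleOn F order fun p s => S.newFeature s (v p) := by
  refine .sum (J := fun p => ZMod d × Fin (order p)) ?_ polyBdd_card_zmod_prod_fin
  let task (r : Σ p, ZMod d × Fin (order p)) : Task d (order r.1) := (v r.1, r.2)
  exact (feasible_isActive hF task).mul (h.output hF task)

theorem system_haltValue : Feasible F (fun n => n) fun n => (S.system n).haltValue := by
  refine (h.allHalted hF).mul (.subst h.halt ?_ ?_)
  · let I (n : ℕ) : Type := S.StateCoord n
    refine .sigma_fin (w := id) (I := I) ?_ ?_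
    · exact feasible_layerNumber
    · exact h.newFeature hF (order := fun r : Σ n, Fin n => r.1) fun r => r.2
  · simpa only [Fintype.card_fin] using PolyBdd.self.add (.const 1)

theorem system_result :
    Feasible F (fun q : Σ n, InCoord n => q.1) fun q s => (S.system q.1).result s q.2 := by
  refine .sigma_sum (w := id) (I := fun n => S.StateCoord n) ?_ ?_
  · exact feasible_adj (order := fun q : Σ n, Fin n × Fin n => q.1) (fun q => q.2.1) fun q => q.2.2
  · exact h.newFeature hF (order := fun q : Σ n, Fin n => q.1) fun q => q.2

theorem system_next :
    Feasible F (fun q : Σ n, S.StateCoord n => q.1) fun q s => (S.system q.1).next s q.2 := by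
  let I (n : ℕ) : Type := S.StateCoord n
  refine .sigma_sum (w := id) (I := I) (.sigma_sum (w := id) (I := I) ?_ ?_)
    (.sigma_sum (w := id) (I := I) (.sigma_sum (w := id) (I := I) ?_ ?_)
      (.sigma_sum (w := id) (I := I) ?_ ?_))
  · exact feasible_adj (order := fun q : Σ n, Fin n × Fin n => q.1) (fun q => q.2.1) fun q => q.2.2
  · let order (q : Σ n, Fin n) : ℕ := q.1
    exact (h.allHalted hF).select (feasible_feature (order := order) fun q => q.2)
      (h.newFeature hF (order := order) fun q => q.2)
  · exact feasible_layerNumber.add (h.allHalted hF (order := fun q : Σ _ : ℕ, Unit => q.1))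
  · exact h.allHalted hF (order := fun q : Σ _ : ℕ, Unit => q.1)
  · let order (q : Σ _ : ℕ, ZMod d) : ℕ := q.1
    exact (h.allHalted hF).select (feasible_phase (order := order) fun q => q.2)
      (feasible_phase (order := order) fun q => q.2 - 1)
  · exact h.freeze_next hF
      (order := fun r : Σ n : ℕ, Σ q : Task d n, S.TaskCoord q => r.1)
      (fun r => r.2.1) fun r => r.2.2

theorem system : FeasibleSystem F (fun n => n) fun n => S.system n where
  card := by
    simpa only [Fintype.card_sum, Fintype.card_prod, Fintype.card_fin] using
      (PolyBdd.self.mul .self).add .self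
  card_aux := h.polyBdd_card_auxCoord
  next := h.system_next hF
  result := h.system_result hF
  haltValue := h.system_haltValue hF

end IsFeasible

end Realization

/-! ### Correctness of the simulation -/

namespace Realization

variable {d : ℕ}

/-- The systems and functions of the realization `S` compute the functions of the network `N`. -/
structure Computes (S : Realization d) (N : RecGNN) : Prop where
  layer : ∀ (i m : ℕ) (x : Fin (m + 1) → ℝ),
    (N.layer i).1 (List.ofFn x) = ((S.layer i m).eval x).map fun y => y ()
  act : ∀ i : ℕ, (N.layer i).2 = S.act i
  halt : ∀ (n : ℕ) (i : ℕ+) (v : Fin n → ℝ),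
    S.halt n (Fin.cons ((i : ℕ) : ℝ) v) = if N.halt i (List.ofFn v) = true then 1 else 0

variable (d) in
/-- The task that is relevant for the vertex `w` in layer `i + 1`. -/
abbrev activeTask (G : LabelledGraph) (i : ℕ) (w : Fin G.order) : Task d G.order :=
  (w, ((i + 1 : ℕ) : ZMod d), ⟨G.degree w, G.degree_lt w⟩)

variable (S : Realization d) (G : LabelledGraph)

/-- The system that performs the relevant task for the vertex `w` in layer `i + 1`, except that it
remains in the first state in which it halts. -/
abbrev activeSystem (i : ℕ) (w : Fin G.order) :
    RealSystem (Fin (G.degree w + 1)) (S.Aux ((i + 1 : ℕ) : ZMod d) (G.degree w)) Unit :=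
  (S.taskSystem (activeTask d G i w)).freeze

/-- The relevant tasks of layer `i + 1`, applied to the features `H`, halt within `k + 1`
iterations. -/
def LayerDone (i k : ℕ) (H : Fin G.order → ℝ) : Prop :=
  ∀ w, (S.activeSystem G i w).HaltsAt (G.layerInput H w) k

/-- The state `s` belongs to iteration `k + 1` of layer `i + 1`, applied to the features `H`. -/
structure Simulates (i k : ℕ) (H : Fin G.order → ℝ) (s : S.StateCoord G.order → ℝ) : Prop where
  coordinates : ∀ c, s (.inl c) = (G.withFeature H).coordinates c
  layerNumber : S.layerNumber s = i + 1
  phase : ∀ c, S.phase s c = if c = ((i + 1 : ℕ) : ZMod d) then 1 else 0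
  current : ∀ w, S.current s (activeTask d G i w) =
    (S.activeSystem G i w).state (G.layerInput H w) k

variable {S G} {N : RecGNN} {i k : ℕ} {H : Fin G.order → ℝ} {s : S.StateCoord G.order → ℝ}

section Graph

variable (hs : ∀ c, s (.inl c) = (G.withFeature H).coordinates c)

include hs

open Classical in
theorem adj_eq (u v : Fin G.order) : S.adj s u v = if G.graph.Adj u v then 1 else 0 :=
  hs (.inl (u, v))

theorem feature_eq (v : Fin G.order) : S.feature s v = H v := hs (.inr v)

theorem degree_eq (w : Fin G.order) : S.degree s w = G.degree w := by
  rw [degree, LabelledGraph.degree]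
  push_cast
  exact Finset.sum_congr rfl fun u _ => adj_eq hs w u

open Classical in
theorem numNeighboursBefore_eq (w u : Fin G.order) :
    S.numNeighboursBefore s w u = (∑ u', if u' < u ∧ G.graph.Adj w u' then 1 else 0 : ℕ) := by
  rw [numNeighboursBefore]
  push_cast
  refine Finset.sum_congr rfl fun u' _ => ?_
  rw [adj_eq hs, ite_and, ite_mul, one_mul, zero_mul]

theorem neighbourFeature_eq (w : Fin G.order) (j : ℕ) :
    S.neighbourFeature s w j = (G.neighbourFeatures H w).getD j 0 := by
  classical
  rw [LabelledGraph.neighbourFeatures, getD_map_filter_finRange, neighbourFeature]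
  refine Finset.sum_congr rfl fun u _ => ?_
  rw [feature_eq hs, adj_eq hs, numNeighboursBefore_eq hs, eqInd_natCast, ite_mul, one_mul,
    zero_mul, ← ite_and, mul_ite, mul_one, mul_zero]

theorem initial_eq (i : ℕ) (w : Fin G.order) :
    S.initial s (activeTask d G i w) = (S.activeSystem G i w).state (G.layerInput H w) 0 := by
  have hinput : (Fin.cons (S.feature s w) fun j : Fin (G.degree w) => S.neighbourFeature s w j) =
      G.layerInput H w :=
    congrArg₂ Fin.cons (feature_eq hs w) (funext fun j => neighbourFeature_eq hs w j)
  exact congrArg (Sum.elim · (S.activeSystem G i w).init) hinput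

theorem current_eq_of_fresh (hfresh : S.fresh s = 1) (i : ℕ) (w : Fin G.order) :
    S.current s (activeTask d G i w) = (S.activeSystem G i w).state (G.layerInput H w) 0 := by
  rw [← initial_eq hs]
  funext x
  rw [current, hfresh, select_one]

end Graph

namespace Simulates

open Classical in
theorem isActive_eq (h : S.Simulates G i k H s) (w : Fin G.order) (p : ZMod d × Fin G.order) :
    S.isActive s (w, p) = if p = (activeTask d G i w).2 then 1 else 0 := by
  rw [isActive, h.phase, degree_eq h.coordinates, eqInd_natCast, ite_mul, one_mul, zero_mul,
    ← ite_and]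
  refine if_congr ?_ rfl rfl
  simp [Prod.ext_iff, Fin.ext_iff, eq_comm]

open Classical in
theorem hasHalted_eq (h : S.Simulates G i k H s) (w : Fin G.order) :
    S.hasHalted s (activeTask d G i w) =
      if (S.activeSystem G i w).HaltsAt (G.layerInput H w) k then 1 else 0 := by
  rw [hasHalted, h.current, signFn]
  exact if_congr Iff.rfl rfl rfl

variable [NeZero d]

theorem sum_isActive_mul (h : S.Simulates G i k H s) (w : Fin G.order)
    (g : ZMod d × Fin G.order → ℝ) :
    ∑ p, S.isActive s (w, p) * g p = g (activeTask d G i w).2 := by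
  classical
  simp [h.isActive_eq]

open Classical in
theorem allHalted_eq (h : S.Simulates G i k H s) :
    S.allHalted s = if S.LayerDone G i k H then 1 else 0 := by
  simp only [allHalted, h.sum_isActive_mul _ fun p => S.hasHalted s (_, p)]
  refine (Finset.prod_congr rfl fun w _ => h.hasHalted_eq w).trans ?_
  simp only [Finset.prod_ite_zero, Finset.mem_univ, true_implies, Finset.prod_const_one]
  exact if_congr Iff.rfl rfl rfl

theorem newFeature_eq (h : S.Simulates G i k H s) (w : Fin G.order) :
    S.newFeature s w = S.act ((i + 1 : ℕ) : ZMod d)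
      ((S.activeSystem G i w).result ((S.activeSystem G i w).state (G.layerInput H w) k) ()) := by
  rw [newFeature, h.sum_isActive_mul w fun p => S.output s (w, p), output, h.current]
  rfl

theorem next_of_not_layerDone (h : S.Simulates G i k H s) (hdone : ¬ S.LayerDone G i k H) :
    S.Simulates G i (k + 1) H ((S.system G.order).next s) := by
  have hall : S.allHalted s = 0 := by rw [h.allHalted_eq, if_neg hdone]
  refine ⟨?_, ?_, fun c => ?_, fun w => ?_⟩
  · rintro (⟨u, v⟩ | v)
    · exact h.coordinates (.inl (u, v))
    · refine Eq.trans ?_ (h.coordinates (.inr v))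
      change select (S.allHalted s) _ _ = _
      rw [hall, select_zero, feature]
  · change S.layerNumber s + S.allHalted s = _
    rw [hall, h.layerNumber, add_zero]
  · change select (S.allHalted s) _ _ = _
    rw [hall, select_zero, h.phase]
  · rw [RealSystem.state_succ, ← h.current]
    funext x
    change select (S.allHalted s) _ _ = _
    rw [hall, select_zero]
    rfl

theorem next_of_layerDone (h : S.Simulates G i k H s) (hdone : S.LayerDone G i k H) :
    S.Simulates G (i + 1) 0 (S.newFeature s) ((S.system G.order).next s) := by
  have hall : S.allHalted s = 1 := by rw [h.allHalted_eq, if_pos hdone]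
  have hcoord : ∀ c, (S.system G.order).next s (.inl c) =
      (G.withFeature (S.newFeature s)).coordinates c := by
    rintro (⟨u, v⟩ | v)
    · exact h.coordinates (.inl (u, v))
    · change select (S.allHalted s) _ _ = _
      rw [hall, select_one]
      rfl
  refine ⟨hcoord, ?_, fun c => ?_, current_eq_of_fresh hcoord hall (i + 1)⟩
  · change S.layerNumber s + S.allHalted s = _
    rw [hall, h.layerNumber, Nat.cast_succ]
  · change select (S.allHalted s) _ _ = _
    rw [hall, select_one, h.phase, Nat.cast_succ (i + 1)]
    exact if_congr sub_eq_iff_eq_add rfl rfl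

theorem result_eq (h : S.Simulates G i k H s) :
    (S.system G.order).result s = (G.withFeature (S.newFeature s)).coordinates := by
  funext c
  obtain ⟨u, v⟩ | v := c
  · exact h.coordinates (.inl (u, v))
  · rfl

end Simulates

variable [NeZero d]

theorem simulates_state_zero :
    S.Simulates G 0 0 G.feature ((S.system G.order).state G.coordinates 0) where
  coordinates _ := rfl
  layerNumber := by simp [layerNumber, RealSystem.state, system]
  phase := by simp [phase, RealSystem.state, system]
  current := current_eq_of_fresh (fun _ => rfl) rfl 0

namespace Computes

variable (hS : S.Computes N)

include hS

omit [NeZero d] in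
theorem exists_layerDone (hH : H ∈ N.features G i) (hdom : (N.features G (i + 1)).Dom) :
    ∃ k, S.LayerDone G i k H := by
  obtain ⟨H', hH'⟩ := Part.dom_iff_mem.1 hdom
  have hhalts : ∀ w, ∃ t, (S.taskSystem (activeTask d G i w)).HaltsAt (G.layerInput H w) t := by
    intro w
    obtain ⟨y, hy, -⟩ := (RecGNN.mem_features_succ_iff hH).1 hH' w
    rw [← G.ofFn_layerInput, hS.layer, Part.mem_map_iff] at hy
    obtain ⟨z, hz, -⟩ := hy
    obtain ⟨t, ht, -⟩ := RealSystem.mem_eval_iff.1 hz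
    exact ⟨t, ht⟩
  choose t ht using hhalts
  exact ⟨Finset.univ.sup t, fun w =>
    RealSystem.freeze_haltsAt_iff.2 ⟨t w, Finset.le_sup (Finset.mem_univ w), ht w⟩⟩

theorem newFeature_mem_features (hH : H ∈ N.features G i) (h : S.Simulates G i k H s)
    (hdone : S.LayerDone G i k H) : S.newFeature s ∈ N.features G (i + 1) := by
  refine (RecGNN.mem_features_succ_iff hH).2 fun w => ?_
  have hmem := Part.mem_map (fun y => y ()) (RealSystem.result_freeze_state_mem_eval (hdone w))
  rw [← hS.layer, G.ofFn_layerInput] at hmem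
  refine ⟨_, hmem, ?_⟩
  rw [h.newFeature_eq, hS.act]
  rfl

theorem haltValue_pos_iff (hH : H ∈ N.features G i) (h : S.Simulates G i k H s) :
    0 < (S.system G.order).haltValue s ↔ S.LayerDone G i k H ∧ N.HaltsAt G i := by
  change 0 < S.allHalted s * _ ↔ _
  rw [h.allHalted_eq]
  by_cases hdone : S.LayerDone G i k H
  · have hmem := hS.newFeature_mem_features hH h hdone
    have hhalts : N.HaltsAt G i ↔ N.halt i.succPNat (List.ofFn (S.newFeature s)) = true := by
      simp only [RecGNN.HaltsAt, Part.eq_some_iff.2 hmem, Part.mem_some_iff, exists_eq_left]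
    rw [if_pos hdone, one_mul, h.layerNumber, ← Nat.cast_succ, ← Nat.succPNat_coe, hS.halt, hhalts]
    split_ifs with hhalt <;> simp [hdone, hhalt]
  · simp [hdone]

variable {t : ℕ}

theorem exists_simulates_of_not_haltsAt
    (ht : ∀ j < t, ¬ (S.system G.order).HaltsAt G.coordinates j) :
    ∃ i k H, H ∈ N.features G i ∧ (∀ j < i, ¬ N.HaltsAt G j) ∧
      S.Simulates G i k H ((S.system G.order).state G.coordinates t) := by
  induction t with
  | zero => exact ⟨0, 0, G.feature, Part.mem_some _, by simp, simulates_state_zero⟩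
  | succ t ih =>
    obtain ⟨i, k, H, hH, hmin, h⟩ := ih fun j hj => ht j (hj.trans t.lt_succ_self)
    rw [RealSystem.state_succ]
    by_cases hdone : S.LayerDone G i k H
    · have hi : ¬ N.HaltsAt G i := fun hi =>
        ht t t.lt_succ_self ((hS.haltValue_pos_iff hH h).2 ⟨hdone, hi⟩)
      exact ⟨i + 1, 0, _, hS.newFeature_mem_features hH h hdone,
        Nat.forall_lt_succ_right.2 ⟨hmin, hi⟩, h.next_of_layerDone hdone⟩
    · exact ⟨i, k + 1, H, hH, hmin, h.next_of_not_layerDone hdone⟩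

theorem exists_layer_end (hH : H ∈ N.features G i) (hdom : (N.features G (i + 1)).Dom)
    (h : S.Simulates G i 0 H ((S.system G.order).state G.coordinates t)) :
    ∃ t k, S.LayerDone G i k H ∧
      S.Simulates G i k H ((S.system G.order).state G.coordinates t) := by
  classical
  have hdone := hS.exists_layerDone hH hdom
  suffices hrun : ∀ k ≤ Nat.find hdone,
      S.Simulates G i k H ((S.system G.order).state G.coordinates (t + k)) from
    ⟨_, _, Nat.find_spec hdone, hrun _ le_rfl⟩
  intro k
  induction k with
  | zero => exact fun _ => h
  | succ k ih =>
    intro hk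
    rw [← add_assoc, RealSystem.state_succ]
    exact (ih (Nat.le_of_succ_le hk)).next_of_not_layerDone (Nat.find_min hdone hk)

theorem exists_layer_start (hdom : (N.features G i).Dom) :
    ∃ t, ∃ H ∈ N.features G i,
      S.Simulates G i 0 H ((S.system G.order).state G.coordinates t) := by
  induction i with
  | zero => exact ⟨0, G.feature, Part.mem_some _, simulates_state_zero⟩
  | succ i ih =>
    obtain ⟨t, H, hH, h⟩ := ih hdom.1
    obtain ⟨t', k, hdone, h'⟩ := hS.exists_layer_end hH hdom h
    refine ⟨t' + 1, _, hS.newFeature_mem_features hH h' hdone, ?_⟩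
    rw [RealSystem.state_succ]
    exact h'.next_of_layerDone hdone

theorem exists_haltsAt (hi : N.HaltsAt G i) :
    ∃ t, (S.system G.order).HaltsAt G.coordinates t := by
  obtain ⟨H', hH', -⟩ := id hi
  have hdom : (N.features G (i + 1)).Dom := Part.dom_iff_mem.2 ⟨H', hH'⟩
  obtain ⟨t, H, hH, h⟩ := hS.exists_layer_start hdom.1
  obtain ⟨t', k, hdone, h'⟩ := hS.exists_layer_end hH hdom h
  exact ⟨t', (hS.haltValue_pos_iff hH h').2 ⟨hdone, hi⟩⟩

theorem exists_mem_eval {y : InCoord G.order → ℝ}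
    (hy : y ∈ (S.system G.order).eval G.coordinates) :
    ∃ H, G.withFeature H ∈ N.eval G ∧ y = (G.withFeature H).coordinates := by
  obtain ⟨t, ht, hmin, rfl⟩ := RealSystem.mem_eval_iff.1 hy
  obtain ⟨i, k, H, hH, hfirst, h⟩ := hS.exists_simulates_of_not_haltsAt hmin
  obtain ⟨hdone, hi⟩ := (hS.haltValue_pos_iff hH h).1 ht
  exact ⟨_, RecGNN.mem_eval_iff.2 ⟨i, hi, hfirst, _, hS.newFeature_mem_features hH h hdone, rfl⟩,
    h.result_eq⟩

theorem system_eval (G : LabelledGraph) :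
    ((S.system G.order).eval G.coordinates).map
        (fun y => List.ofFn (y ∘ (inCoordEquiv G.order).symm)) =
      (N.eval G).map LabelledGraph.encode := by
  ext z
  simp only [Part.mem_map_iff]
  constructor
  · rintro ⟨y, hy, rfl⟩
    obtain ⟨H, hH, rfl⟩ := hS.exists_mem_eval hy
    exact ⟨_, hH, LabelledGraph.encode_eq_ofFn _⟩
  · rintro ⟨G', hG', rfl⟩
    obtain ⟨i, hi, -⟩ := RecGNN.mem_eval_iff.1 hG'
    obtain ⟨y, hy⟩ : ∃ y, y ∈ (S.system G.order).eval G.coordinates :=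
      Part.dom_iff_mem.1 ⟨hS.exists_haltsAt hi, trivial⟩
    obtain ⟨H, hH, rfl⟩ := hS.exists_mem_eval hy
    obtain rfl := Part.mem_unique hG' hH
    exact ⟨_, hy, (LabelledGraph.encode_eq_ofFn _).symm⟩

end Computes

end Realization

theorem RecGNN.exists_realization {F : CircuitClass} {N : RecGNN} {d : ℕ} [NeZero d]
    (hper : Function.Periodic N.layer d)
    (hfun : ∀ i, (fun x => ((N.layer i).1 x).map fun y => [y]) ∈ recClass F F)
    (hact : ∀ i, (N.layer i).2 ∈ F.gates)
    (hhalt : ∃ D : ∀ k, Circuit k 1, F.IsFamily D ∧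
      ∀ p, ComputesHalt (D (p + 1)) fun i (v : Fin p → ℝ) => N.halt i (List.ofFn v)) :
    ∃ S : Realization d, S.IsFeasible F ∧ S.Computes N := by
  choose ℓ T hT hcomp using fun c : ZMod d => FeasibleSystem.exists_eval_eq (hfun c.val)
  obtain ⟨D, hD, hDhalt⟩ := hhalt
  have hval : ∀ i : ℕ, N.layer (i : ZMod d).val = N.layer i := fun i => by
    rw [ZMod.val_natCast, hper.map_mod_nat]
  let S : Realization d :=
    { Aux := fun c m => Unit ⊕ Fin (ℓ c (m + 1))
      layer := fun c m => T c (m + 1)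
      act := fun c => (N.layer c.val).2
      halt := fun n x => (D (n + 1)).eval x Fin.elim0 0 }
  refine ⟨S, ⟨?_, fun c => hact _, ?_⟩, ⟨fun i m x => ?_, fun i => ?_, fun n i v => hDhalt n i v⟩⟩
  · exact ((FeasibleSystem.sigma hT).reindex fun q : Σ _ : ZMod d, ℕ => ⟨q.1, q.2 + 1⟩).reweight
      (PolyBdd.self.add (.const 1))
  · exact ((feasible_eval hD).reindex (· + 1)).reweight (PolyBdd.self.add (.const 1))
  · rw [← hval, hcomp]
  · rw [← hval]

end

end RecCirc

theorem mainTheorem3_general {E F : RecCirc.CircuitClass} (hE : RecCirc.signFn ∈ E.gates)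
    (hF : RecCirc.signFn ∈ F.gates) {N : RecCirc.RecGNN}
    (hper : ∃ d, 0 < d ∧ Function.Periodic N.layer d)
    (hfun : ∀ i, (fun x => ((N.layer i).1 x).map fun y => [y]) ∈ RecCirc.recClass F F)
    (hact : ∀ i, (N.layer i).2 ∈ F.gates)
    (hhalt : ∃ D : ∀ k, RecCirc.Circuit k 1, F.IsFamily D ∧
      ∀ p, RecCirc.ComputesHalt (D (p + 1)) fun i (v : Fin p → ℝ) => N.halt i (List.ofFn v)) :
    ∃ f ∈ RecCirc.recClass E F,
      ∀ G : RecCirc.LabelledGraph, f G.encode = (N.eval G).map RecCirc.LabelledGraph.encode := by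
  obtain ⟨d, hd, hper⟩ := hper
  have : NeZero d := ⟨hd.ne'⟩
  obtain ⟨S, hS, hSN⟩ := N.exists_realization hper hfun hact hhalt
  have hsystem : RecCirc.FeasibleSystem F (fun n => n * n + n) fun n => S.system n :=
    (hS.system hF).reweight (.mono .self fun n => Nat.le_add_left n (n * n))
  obtain ⟨f, hf, heval⟩ := hsystem.exists_mem_recClass hE RecCirc.mul_self_add_self_injective
    RecCirc.inCoordEquiv
  refine ⟨f, hf, fun G => ?_⟩
  rw [RecCirc.LabelledGraph.encode_eq_ofFn, heval, hSN.system_eval]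

theorem mainTheorem3 (F : RecCirc.CircuitClass) (A : Set (ℝ → ℝ)) (N : RecCirc.RecGNN)
    (hN : N.IsOfType F.withSign F.withSign F A) :
    ∃ f ∈ RecCirc.recClass F.withSign (F.withSign.adjoin A),
      ∀ G : RecCirc.LabelledGraph, f G.encode = (N.eval G).map RecCirc.LabelledGraph.encode := by
  obtain ⟨hper, hlayer, -, D, hD, hhalt⟩ := hN
  set F' := F.withSign.adjoin A
  have hsub : F.withSign.gates ⊆ F'.gates := Set.subset_union_left
  have hsign : RecCirc.signFn ∈ F.withSign.gates := .inr rfl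
  have hmono : RecCirc.recClass F.withSign F ⊆ RecCirc.recClass F' F' :=
    RecCirc.recClass_mono rfl hsub rfl (Set.subset_union_left.trans hsub)
  have hD' : F'.IsFamily D := RecCirc.isFamily_mono (F := F.withSign) (F' := F') rfl hsub hD
  exact mainTheorem3_general hsign (hsub hsign) hper (fun i => hmono (hlayer i).1.2)
    (fun i => .inr (hlayer i).2) ⟨D, hD', hhalt⟩
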